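/- **Theorem.** For all $n,d\in\mathbb N$ with $n\ge 1$, let $N=(d+2)n$, identify $\mathbb Z_2^n$ with the set $S_0\subseteq\mathbb Z_2^{N}$ of the numbers $0,\dots,2^n-1$ (padding with zeros), and for $f:\mathbb Z_2^n\to\mathbb Z_2^n$ let a random $(d,f)$-shuffling be $F=(f_0,\dots,f_d)$, where $f_0,\dots,f_{d-1}$ are independent uniformly random one-to-one functions $\mathbb Z_2^{N}\to\mathbb Z_2^{N}$, and $f_d$ is the function that satisfies $f_d(f_{d-1}\circ\cdots\circ f_0(x))=f(x)$ for $x\in S_0$ and that takes the value $\bot$ outside $S_d=f_{d-1}\circ\cdots\circ f_0(S_0)$. In the $d$-shuffling Simon's problem ($d$-SSP), with probability $1/2$ each, $f$ is a uniformly random Simon function (there is $s\ne0$ such that $f(x)=f(y)$ iff $y\in\{x,x\oplus s\}$) or a uniformly random one-to-one function on $\mathbb Z_2^n$; given oracle access to a random $(d,f)$-shuffling $F$, one has to decide which is the case. A $d$-CQ scheme is a randomized classical algorithm that may adaptively query $F$ classically and run $d$-depth quantum circuits $U_{d+1}F\,U_d\cdots F\,U_1$ on the initial state $|0\cdots0\rangle$,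 receiving each time only the outcome of the measurement of all qubits in the standard basis; here each call of $F$ is a parallel query $|x\rangle|y\rangle\mapsto|x\rangle|y\oplus f_i(x)\rangle$ on a fixed number of query registers for each level $i=0,\dots,d$, where $\bot$ is encoded by a separate flag bit in the answer. The layers $U_i$ may be arbitrary unitaries on the qubits of the circuit (in particular, layers of one- and two-qubit gates), and the computation of the classical algorithm between its queries and circuit runs is not restricted (in particular, it may be polynomial time). Then for every polynomial $p$ there is a polynomial $r$ such that for all $n\ge1$ and all $d$, every $d$-CQ scheme whose quantum circuits use at most $p(n)$ qubits and which makes, in total, at most $p(n)$ classical queries and circuit runs decides the $d$-SSP correctly with probability at most $$\frac12+\sqrt{\frac{r(n)}{2^n}} .$$ In other words, no $d$-CQ scheme decides the $d$-SSP with probability greater than $\frac12+\sqrt{\mathrm{poly}(n)/2^n}$. -/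

import Mathlib

open scoped BigOperators

noncomputable section

namespace ShufflingSimon

/-! ### Simon functions and the shuffling oracle -/

/-- The group `ℤ₂ᵏ` of bit strings of length `k`; addition is bitwise xor. -/
abbrev Bits (k : ℕ) : Type := Fin k → ZMod 2

/-- `f` is a Simon function: two-to-one with a nonzero hidden shift `s`. -/
def IsSimon {n : ℕ} (f : Bits n → Bits n) : Prop :=
  ∃ s : Bits n, s ≠ 0 ∧ ∀ x y : Bits n, f x = f y ↔ y = x ∨ y = x + s

open scoped Classical in
/-- The finite set of all Simon functions on `ℤ₂ⁿ`. -/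
def simonFunctions (n : ℕ) : Finset (Bits n → Bits n) :=
  Finset.univ.filter IsSimon

open scoped Classical in
/-- The finite set of all one-to-one functions on `ℤ₂ⁿ`. -/
def injectiveFunctions (n : ℕ) : Finset (Bits n → Bits n) :=
  Finset.univ.filter Function.Injective

/-- The enlarged domain `ℤ₂^((d+2)n)` on which every level of the shuffling is defined. -/
abbrev Dom (n d : ℕ) : Type := Bits ((d + 2) * n)

/-- The embedding of `ℤ₂ⁿ` into the enlarged domain by zero-padding. Its range is the set
`S₀ = {0, …, 2ⁿ - 1}`. -/
def pad {n d : ℕ} (x : Bits n) : Dom n d :=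
  fun i => if h : (i : ℕ) < n then x ⟨i, h⟩ else 0

/-- The `d` one-to-one functions `f₀, …, f_{d-1}` of a shuffling. -/
abbrev Levels (n d : ℕ) : Type := Fin d → Equiv.Perm (Dom n d)

/-- The composition `f_{d-1} ∘ ⋯ ∘ f₀`. -/
def chain {n d : ℕ} (σ : Levels n d) : Equiv.Perm (Dom n d) :=
  (List.ofFn σ).reverse.prod

/-- The last function `f_d` of the `(d, f)`-shuffling with levels `σ`: on
`S_d = f_{d-1} ∘ ⋯ ∘ f₀ (S₀)` it is the map with `f_d ∘ ⋯ ∘ f₀ = f` on `S₀`, and outside `S_d` its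
value is `⊥` (that is, `none`). -/
def lastLevel {n d : ℕ} (σ : Levels n d) (f : Bits n → Bits n) (y : Dom n d) :
    Option (Bits n) :=
  (Function.partialInv (fun x : Bits n => chain σ (pad x)) y).map f

/-- Answers of the oracle as bit strings: an element of the enlarged domain and a flag bit, which
is `1` exactly for the answer `⊥`. -/
abbrev Answer (n d : ℕ) : Type := Dom n d × ZMod 2

/-- The `(d, f)`-shuffling `(f₀, …, f_d)` with levels `σ`, as a function of the index `j` and the
point `x` queried. -/
def shuffling {n d : ℕ} (σ : Levels n d) (f : Bits n → Bits n)
    (j : Fin (d + 1)) (x : Dom n d) : Answer n d :=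
  if h : (j : ℕ) < d then (σ ⟨j, h⟩ x, 0)
  else
    match lastLevel σ f x with
    | some y => (pad y, 0)
    | none => (0, 1)

/-! ### Quantum circuits with `d` parallel oracle calls -/

/-- Computational basis of the registers of a circuit: for every level `i ≤ d` there are `q` query
registers, each consisting of a point and an answer register; there are `w` work qubits. -/
abbrev Basis (n d q w : ℕ) : Type :=
  (Fin (d + 1) → Fin q → Dom n d × Answer n d) × Bits w

instance (n d : ℕ) : DecidableEq (Answer n d) := inferInstance

instance (n d q w : ℕ) : DecidableEq (Basis n d q w) := instDecidableEqProd

/-- The number of qubits of these registers. -/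
def numQubits (n d q w : ℕ) : ℕ :=
  (d + 1) * q * ((d + 2) * n + ((d + 2) * n + 1)) + w

/-- State vectors, as families of amplitudes. -/
abbrev State (n d q w : ℕ) : Type := Basis n d q w → ℂ

/-- The action of one parallel oracle call on basis states:
`|x, y⟩ ↦ |x, y ⊕ F i x⟩` in each query register of level `i`. -/
def queryPerm {n d : ℕ} (q w : ℕ) (F : Fin (d + 1) → Dom n d → Answer n d) :
    Equiv.Perm (Basis n d q w) where
  toFun b := (fun i t => ((b.1 i t).1, (b.1 i t).2 + F i (b.1 i t).1), b.2)
  invFun b := (fun i t => ((b.1 i t).1, (b.1 i t).2 - F i (b.1 i t).1), b.2)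
  left_inv b := by simp
  right_inv b := by simp

/-- The oracle unitary, i.e. the linear map with `|b⟩ ↦ |queryPerm b⟩`. -/
def applyOracle {n d q w : ℕ} (F : Fin (d + 1) → Dom n d → Answer n d) (ψ : State n d q w) :
    State n d q w :=
  fun b => ψ ((queryPerm q w F).symm b)

/-- A `d`-depth quantum circuit with oracle access, `U_{d+1} F U_d ⋯ F U_1`: there are `d` layers,
each followed by a parallel oracle call, and one final layer. A layer is allowed to be an
arbitrary unitary, in particular a layer of one- and two-qubit gates. -/
structure Circuit (n d q w : ℕ) where
  /-- the layers before the oracle calls -/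
  layer : Fin d → Matrix.unitaryGroup (Basis n d q w) ℂ
  /-- the layer after the last oracle call -/
  final : Matrix.unitaryGroup (Basis n d q w) ℂ

namespace Circuit

variable {n d q w : ℕ}

/-- The state after the first `k` layers and oracle calls, from the initial state `|0⋯0⟩`. -/
def stateAfter (C : Circuit n d q w) (F : Fin (d + 1) → Dom n d → Answer n d) :
    (k : ℕ) → k ≤ d → State n d q w
  | 0, _ => Pi.single 0 1
  | k + 1, h =>
      applyOracle F ((C.layer ⟨k, h⟩ : Matrix (Basis n d q w) (Basis n d q w) ℂ).mulVec
        (C.stateAfter F k (Nat.le_of_succ_le h)))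

/-- The state at the end of the circuit. -/
def finalState (C : Circuit n d q w) (F : Fin (d + 1) → Dom n d → Answer n d) : State n d q w :=
  (C.final : Matrix (Basis n d q w) (Basis n d q w) ℂ).mulVec (C.stateAfter F d le_rfl)

/-- The probability that measuring all qubits at the end in the standard basis gives `z`. -/
def outcomeProb (C : Circuit n d q w) (F : Fin (d + 1) → Dom n d → Answer n d)
    (z : Basis n d q w) : ℝ :=
  ‖C.finalState F z‖ ^ 2

end Circuit

/-! ### Classical-quantum schemes -/

/-- A `d`-depth classical-quantum scheme with oracle access for input length `n`, unfolded as the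
decision tree of its classical randomized algorithm. The algorithm can flip coins, query the oracle
classically, and run a `d`-depth quantum circuit (chosen by it) from a fresh initial state, of which
it receives the outcome of the measurement of all qubits; finally it outputs a bit. Between these
steps its computation is unrestricted. -/
inductive CQScheme (n d q w : ℕ) : Type
  | output (b : Bool) : CQScheme n d q w
  | coin (next : Bool → CQScheme n d q w) : CQScheme n d q w
  | query (j : Fin (d + 1)) (x : Dom n d) (next : Answer n d → CQScheme n d q w) :
      CQScheme n d q w
  | run (C : Circuit n d q w) (next : Basis n d q w → CQScheme n d q w) : CQScheme n d q w

namespace CQScheme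

variable {n d q w : ℕ}

/-- The probability that the scheme with access to the oracle `F` outputs `1`. -/
def acceptProb (F : Fin (d + 1) → Dom n d → Answer n d) : CQScheme n d q w → ℝ
  | output b => if b then 1 else 0
  | coin next => ((next false).acceptProb F + (next true).acceptProb F) / 2
  | query j x next => (next (F j x)).acceptProb F
  | run C next => ∑ z, C.outcomeProb F z * (next z).acceptProb F

/-- The largest total number of classical oracle queries and circuit runs in an execution. -/
def steps : CQScheme n d q w → ℕ
  | output _ => 0
  | coin next => max (next false).steps (next true).steps
  | query _ _ next => 1 + Finset.univ.sup fun a => (next a).steps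
  | run _ next => 1 + Finset.univ.sup fun z => (next z).steps

/-- The probability that the scheme decides the `d`-shuffling Simon's problem correctly. With
probability `1/2` each, `f` is a uniformly random Simon function (the correct output is `1`) or a
uniformly random one-to-one function (the correct output is `0`), and the oracle is a uniformly
random `(d, f)`-shuffling. -/
def successProb (A : CQScheme n d q w) : ℝ :=
  1 / 2 * (𝔼 f ∈ simonFunctions n, 𝔼 σ : Levels n d, A.acceptProb (shuffling σ f))
    + 1 / 2 * (𝔼 f ∈ injectiveFunctions n, 𝔼 σ : Levels n d,
        (1 - A.acceptProb (shuffling σ f)))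

end CQScheme

end ShufflingSimon

end

/-! To read a value of `f` one has to follow a path from `pad x` through all `d + 1` levels, while a
circuit has only `d` parallel calls. A call can bring the paths one level further, but their later
points are still uniformly random in a domain of size `2 ^ ((d + 2) * n)`, and a circuit puts
noticeable query weight on few points. So each circuit can be replaced by one that depends on few
values of `f`, and few values hardly distinguish Simon functions from one-to-one functions.

Sampling: the levels are built from independent base permutations and independent path points, each
level being corrected by transpositions that force the paths through it. The result is exactly
uniform, by a symmetry argument (`expect_trueLevels`), and the transpositions rarely interfere
(`expect_not_isGood_le`).

Simulation: call `k`, counted from 0, is answered correctly on the levels up to `k`, and beyond them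
only on the paths of a set `T`. Before the call, `T` receives every `x` with a relevant point of
mass above a threshold beyond level `k`. A hybrid argument bounds the error
(`sum_abs_outcomeProb_sub_simProb_le`). Since `k < d`, the last level is never opened completely, so
only the values of `f` on `T` matter. The points that cause hits at call `k` are still fresh and
independent for different `x`; hence finding `r` new paths is exponentially unlikely in `r`
(`expect_subset_found_le`, `expect_found_threshold_le`).

Adaptivity: later circuits depend on the sample through earlier answers. A union bound over all
transcripts (`expect_overflow_le`) removes this dependence; the tail `4 ^ (-r)` beats their number
for polynomial `r`.

Comparison: for a fixed sample the simulated rejection probability is a nonnegative combination of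
indicators of events on at most `Q` values of `f` (`isLocal_simReject`). Each such event is at least
`1 - 2 * Q ^ 2 / 2 ^ n` times as likely for a Simon function as for a one-to-one function
(`IsLocal.expect_injective_le`). This direction suffices: the success probability exceeds `1 / 2` by
half the excess of rejection on one-to-one functions over rejection on Simon functions. -/

noncomputable section

namespace ShufflingSimon

open Finset Equiv

/-! ### Rerouting permutations -/

section Reroute

variable {ι α : Type*} [DecidableEq α]

/-- The product of the transpositions of `p x` and `q x` over `x ∈ T`. -/
def reroute (T : Finset ι) (p q : ι → α) : Perm α :=
  (T.toList.map fun x => swap (p x) (q x)).prod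

/-- Conjugation of a transposition renames its two points. This is the source of the symmetry behind
`expect_trueLevels`. -/
theorem reroute_conj (T : Finset ι) (p q : ι → α) (g : Perm α) :
    reroute T (fun x => g (p x)) (fun x => g (q x)) = g * reroute T p q * g⁻¹ := by
  unfold reroute
  induction T.toList with
  | nil => simp
  | cons a l ih =>
    rw [List.map_cons, List.prod_cons, ih, swap_apply_apply, List.map_cons, List.prod_cons]
    group

theorem reroute_congr {T : Finset ι} {p q p' q' : ι → α} (hp : ∀ x ∈ T, p x = p' x)
    (hq : ∀ x ∈ T, q x = q' x) : reroute T p q = reroute T p' q' := by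
  unfold reroute
  congr 1
  apply List.map_congr_left
  intro x hx
  rw [Finset.mem_toList] at hx
  rw [hp x hx, hq x hx]

/-- The families `p` and `q` are injective and have disjoint ranges. -/
structure Separated (p q : ι → α) : Prop where
  left : Function.Injective p
  right : Function.Injective q
  ne : ∀ x y, p x ≠ q y

variable {p q : ι → α}

theorem reroute_list_apply_of_ne (l : List ι) {z : α} (hp : ∀ x ∈ l, z ≠ p x)
    (hq : ∀ x ∈ l, z ≠ q x) : (l.map fun x => swap (p x) (q x)).prod z = z := by
  induction l with
  | nil => simp
  | cons a l ih =>
    rw [List.map_cons, List.prod_cons, Perm.mul_apply,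
      ih (fun x hx => hp x (by simp [hx])) (fun x hx => hq x (by simp [hx]))]
    exact swap_apply_of_ne_of_ne (hp a (by simp)) (hq a (by simp))

theorem reroute_apply_of_ne {T : Finset ι} {z : α} (hp : ∀ x ∈ T, z ≠ p x)
    (hq : ∀ x ∈ T, z ≠ q x) : reroute T p q z = z :=
  reroute_list_apply_of_ne T.toList (fun x hx => hp x (by simpa using hx))
    fun x hx => hq x (by simpa using hx)

/-- For separated families the transpositions have pairwise disjoint supports, so exactly one of
them moves `p x` and `q x`. -/
theorem reroute_list_apply (h : Separated p q) {l : List ι} (hl : l.Nodup) {x : ι} (hx : x ∈ l) :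
    (l.map fun x => swap (p x) (q x)).prod (p x) = q x ∧
      (l.map fun x => swap (p x) (q x)).prod (q x) = p x := by
  induction l with
  | nil => simp at hx
  | cons a l ih =>
    rw [List.nodup_cons] at hl
    simp only [List.map_cons, List.prod_cons, Perm.mul_apply]
    by_cases hxl : x ∈ l
    · have hxa : x ≠ a := fun e => hl.1 (e ▸ hxl)
      rw [(ih hl.2 hxl).1, (ih hl.2 hxl).2]
      exact ⟨swap_apply_of_ne_of_ne (h.ne _ _).symm (h.right.ne hxa),
        swap_apply_of_ne_of_ne (h.left.ne hxa) (h.ne _ _)⟩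
    · obtain rfl : x = a := by simpa [hxl] using hx
      rw [reroute_list_apply_of_ne l (z := p x)
          (fun y hy => h.left.ne fun e => hxl (e ▸ hy)) (fun y _ => h.ne _ _),
        reroute_list_apply_of_ne l (z := q x)
          (fun y _ => (h.ne _ _).symm) (fun y hy => h.right.ne fun e => hxl (e ▸ hy))]
      exact ⟨swap_apply_left _ _, swap_apply_right _ _⟩

theorem reroute_apply_left (h : Separated p q) {T : Finset ι} {x : ι} (hx : x ∈ T) :
    reroute T p q (p x) = q x :=
  (reroute_list_apply h T.nodup_toList (by simpa using hx)).1

theorem reroute_apply_right (h : Separated p q) {T : Finset ι} {x : ι} (hx : x ∈ T) :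
    reroute T p q (q x) = p x :=
  (reroute_list_apply h T.nodup_toList (by simpa using hx)).2

theorem reroute_eq_reroute_of_ne (h : Separated p q) {S T : Finset ι} (hTS : T ⊆ S) {z : α}
    (hp : ∀ x ∈ S, x ∉ T → z ≠ p x) (hq : ∀ x ∈ S, x ∉ T → z ≠ q x) :
    reroute S p q z = reroute T p q z := by
  by_cases h₁ : ∃ x ∈ T, z = p x
  · obtain ⟨x, hx, rfl⟩ := h₁
    rw [reroute_apply_left h hx, reroute_apply_left h (hTS hx)]
  by_cases h₂ : ∃ x ∈ T, z = q x
  · obtain ⟨x, hx, rfl⟩ := h₂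
    rw [reroute_apply_right h hx, reroute_apply_right h (hTS hx)]
  push Not at h₁ h₂
  rw [reroute_apply_of_ne h₁ h₂, reroute_apply_of_ne]
  · intro x hx
    by_cases hxT : x ∈ T
    exacts [h₁ x hxT, hp x hx hxT]
  · intro x hx
    by_cases hxT : x ∈ T
    exacts [h₂ x hxT, hq x hx hxT]

end Reroute

/-! ### Shufflings with independently sampled paths -/

/-- A sample: one permutation for every level, and for every `x` a sequence of points that become
the points after `pad x` of the path that starts in `pad x`. -/
abbrev Sample (n d : ℕ) : Type := Levels n d × (Bits n → Fin d → Dom n d)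

variable {n d q w : ℕ}

/-- The point in which the path of `x` enters the level `j`. -/
def pathPoint (ω : Sample n d) : ℕ → Bits n → Dom n d
  | 0, x => pad x
  | j + 1, x => if h : j < d then ω.2 x ⟨j, h⟩ else 0

/-- The level `j` of the sample, changed such that the paths of the `x ∈ T` pass through it. -/
def routed (ω : Sample n d) (T : Finset (Bits n)) (j : Fin d) : Perm (Dom n d) :=
  reroute T (fun x => ω.1 j (pathPoint ω j x)) (pathPoint ω (j + 1)) * ω.1 j

/-- The levels of the shuffling that belongs to a sample. -/
def trueLevels (ω : Sample n d) : Levels n d := fun j => routed ω univ j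

/-- No two points of different paths meet in such a way that rerouting fails. -/
def IsGood (ω : Sample n d) : Prop :=
  ∀ j : Fin d, Separated (fun x => ω.1 j (pathPoint ω j x)) (pathPoint ω (j + 1))

theorem pad_injective : Function.Injective (pad : Bits n → Dom n d) := by
  intro x y h
  funext i
  have hi : (i : ℕ) < (d + 2) * n := lt_of_lt_of_le i.2 (Nat.le_mul_of_pos_left n (by omega))
  have := congrFun h ⟨i, hi⟩
  simpa [pad] using this

theorem IsGood.pathPoint_injective {ω : Sample n d} (h : IsGood ω) {j : ℕ} (hj : j ≤ d) :
    Function.Injective (pathPoint ω j) := by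
  cases j with
  | zero => exact pad_injective
  | succ j => exact (h ⟨j, hj⟩).right

theorem trueLevels_apply_pathPoint {ω : Sample n d} (h : IsGood ω) (j : Fin d) (x : Bits n) :
    trueLevels ω j (pathPoint ω j x) = pathPoint ω (j + 1) x :=
  reroute_apply_left (h j) (mem_univ x)

theorem prod_reverse_ofFn_apply {α : Type*} {d : ℕ} (σ : Fin d → Perm α) (a : ℕ → α)
    (h : ∀ j : Fin d, σ j (a j) = a (j + 1)) : (List.ofFn σ).reverse.prod (a 0) = a d := by
  induction d generalizing a with
  | zero => simp
  | succ d ih =>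
    rw [List.ofFn_succ, List.reverse_cons, List.prod_append, List.prod_singleton, Perm.mul_apply,
      show σ 0 (a 0) = a 1 from h 0]
    exact ih (fun j => σ j.succ) (fun j => a (j + 1)) fun j => h j.succ

theorem chain_trueLevels {ω : Sample n d} (h : IsGood ω) (x : Bits n) :
    chain (trueLevels ω) (pad x) = pathPoint ω d x :=
  prod_reverse_ofFn_apply (trueLevels ω) (fun j => pathPoint ω j x)
    fun j => trueLevels_apply_pathPoint h j x

theorem lastLevel_chain (σ : Levels n d) (f : Bits n → Bits n) (x : Bits n) :
    lastLevel σ f (chain σ (pad x)) = some (f x) := by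
  have hinj : Function.Injective fun x : Bits n => chain σ (pad x) :=
    (chain σ).injective.comp pad_injective
  unfold lastLevel
  rw [Function.partialInv_left hinj x]
  rfl

theorem lastLevel_of_forall_ne (σ : Levels n d) (f : Bits n → Bits n) {y : Dom n d}
    (h : ∀ x, chain σ (pad x) ≠ y) : lastLevel σ f y = none := by
  unfold lastLevel Function.partialInv
  rw [dif_neg (by simpa using h)]
  rfl

open scoped Classical in
/-- The answer of the last level if the function is only known on `T`. -/
def partialAnswer (ω : Sample n d) (f : Bits n → Bits n) (T : Finset (Bits n)) (y : Dom n d) :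
    Answer n d :=
  if h : ∃ x ∈ T, pathPoint ω d x = y then (pad (f h.choose), 0) else (0, 1)

/-- The oracle of the simulation after the layer `k`: on the levels up to `k` it is correct, on the
later levels it is correct on the paths of the `x ∈ T` only. -/
def simOracle (ω : Sample n d) (f : Bits n → Bits n) (T : Finset (Bits n)) (k : ℕ)
    (j : Fin (d + 1)) (y : Dom n d) : Answer n d :=
  if h : (j : ℕ) < d then (routed ω (if (j : ℕ) ≤ k then univ else T) ⟨j, h⟩ y, 0)
  else partialAnswer ω f T y

/-- The other point of the level `j` at which it is changed for the sake of the path of `x`. -/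
def backPoint (ω : Sample n d) (j : Fin (d + 1)) (x : Bits n) : Dom n d :=
  if h : (j : ℕ) < d then (ω.1 ⟨j, h⟩).symm (ω.2 x ⟨j, h⟩) else pathPoint ω j x

/-- Omitting the transposition of `x` on a level affects only two arguments: the entry point of the
path and the point that the base permutation sends to the next path point. By `k < d` the last level
counts as a later one, so `h₁` applies to it. -/
theorem simOracle_eq_shuffling {ω : Sample n d} (hω : IsGood ω) (f : Bits n → Bits n)
    (T : Finset (Bits n)) (k : ℕ) (j : Fin (d + 1)) (y : Dom n d)
    (h₁ : k < (j : ℕ) → ∀ x ∉ T, y ≠ pathPoint ω j x)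
    (h₂ : k < (j : ℕ) → ∀ x ∉ T, y ≠ backPoint ω j x) (hk : k < d) :
    simOracle ω f T k j y = shuffling (trueLevels ω) f j y := by
  unfold simOracle shuffling
  by_cases hj : (j : ℕ) < d
  · rw [dif_pos hj, dif_pos hj]
    by_cases hjk : (j : ℕ) ≤ k
    · rw [if_pos hjk]; rfl
    · rw [if_neg hjk]
      push Not at hjk
      congr 1
      refine (reroute_eq_reroute_of_ne (hω ⟨j, hj⟩) (subset_univ T) ?_ ?_).symm
      · intro x _ hx e
        exact h₁ hjk x hx ((ω.1 ⟨j, hj⟩).injective e)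
      · intro x _ hx e
        apply h₂ hjk x hx
        rw [backPoint, dif_pos hj, Equiv.eq_symm_apply, e]
        simp [pathPoint, hj]
  · rw [dif_neg hj, dif_neg hj]
    have hjd : (j : ℕ) = d := by omega
    have hpd := hω.pathPoint_injective le_rfl
    by_cases hx : ∃ x, pathPoint ω d x = y
    · obtain ⟨x, rfl⟩ := hx
      have hxT : x ∈ T := by
        by_contra hxT
        exact h₁ (by omega) x hxT (by rw [hjd])
      have hex : ∃ x' ∈ T, pathPoint ω d x' = pathPoint ω d x := ⟨x, hxT, rfl⟩
      have : lastLevel (trueLevels ω) f (pathPoint ω d x) = some (f x) := by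
        rw [← chain_trueLevels hω, lastLevel_chain]
      rw [partialAnswer, dif_pos hex, this, hpd hex.choose_spec.2]
    · push Not at hx
      have : lastLevel (trueLevels ω) f y = none :=
        lastLevel_of_forall_ne _ _ fun x => by rw [chain_trueLevels hω]; exact hx x
      rw [this, partialAnswer, dif_neg (by push Not; exact fun x _ => hx x)]

/-! ### The Euclidean norm of state vectors -/

section Norm

variable {ι : Type*} [Fintype ι]

/-- The Euclidean norm of a family of amplitudes. -/
def l2 (ψ : ι → ℂ) : ℝ := ‖(WithLp.toLp 2 ψ : EuclideanSpace ℂ ι)‖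

theorem l2_nonneg (ψ : ι → ℂ) : 0 ≤ l2 ψ := norm_nonneg _

theorem l2_sq (ψ : ι → ℂ) : l2 ψ ^ 2 = ∑ b, ‖ψ b‖ ^ 2 := by
  rw [l2, EuclideanSpace.norm_sq_eq]

theorem l2_add_le (ψ φ : ι → ℂ) : l2 (ψ + φ) ≤ l2 ψ + l2 φ := norm_add_le _ _

theorem l2_sub_le (ψ φ : ι → ℂ) : l2 (ψ - φ) ≤ l2 ψ + l2 φ := norm_sub_le _ _

theorem l2_comp_equiv (ψ : ι → ℂ) (e : Perm ι) : l2 (fun b => ψ (e b)) = l2 ψ := by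
  rw [← sq_eq_sq₀ (l2_nonneg _) (l2_nonneg _), l2_sq, l2_sq]
  exact Equiv.sum_comp e fun b => ‖ψ b‖ ^ 2

theorem l2_mulVec [DecidableEq ι] (U : Matrix.unitaryGroup ι ℂ) (ψ : ι → ℂ) :
    l2 ((U : Matrix ι ι ℂ).mulVec ψ) = l2 ψ := by
  rw [← sq_eq_sq₀ (l2_nonneg _) (l2_nonneg _), l2_sq, l2_sq]
  have key : ∀ v : ι → ℂ, ((∑ b, ‖v b‖ ^ 2 : ℝ) : ℂ) = star v ⬝ᵥ v := by
    intro v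
    rw [dotProduct]
    push_cast
    refine sum_congr rfl fun b _ => ?_
    rw [Pi.star_apply, Complex.star_def, Complex.conj_mul']
  have h : (star (U : Matrix ι ι ℂ)) * (U : Matrix ι ι ℂ) = 1 :=
    Matrix.UnitaryGroup.star_mul_self U
  apply Complex.ofReal_injective
  rw [key, key, Matrix.star_mulVec, ← Matrix.dotProduct_mulVec, Matrix.mulVec_mulVec,
    ← Matrix.star_eq_conjTranspose, h, Matrix.one_mulVec]

/-- Difference of squares and Cauchy–Schwarz. This turns the distance of final states into a
distance of outcome distributions. -/
theorem sum_abs_sq_sub_sq_le (u v : ι → ℂ) :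
    ∑ b, |‖u b‖ ^ 2 - ‖v b‖ ^ 2| ≤ l2 (u - v) * (l2 u + l2 v) := by
  have h₁ : ∀ b, |‖u b‖ ^ 2 - ‖v b‖ ^ 2| ≤ ‖(u - v) b‖ * ‖u b‖ + ‖(u - v) b‖ * ‖v b‖ := by
    intro b
    rw [← mul_add, sq_sub_sq, abs_mul, mul_comm, abs_of_nonneg (a := ‖u b‖ + ‖v b‖) (by positivity)]
    exact mul_le_mul_of_nonneg_right (abs_norm_sub_norm_le _ _) (by positivity)
  have cs : ∀ u v : ι → ℂ, ∑ b, ‖u b‖ * ‖v b‖ ≤ l2 u * l2 v := by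
    intro u v
    have := Finset.sum_mul_sq_le_sq_mul_sq univ (fun b => ‖u b‖) fun b => ‖v b‖
    rw [← l2_sq, ← l2_sq, ← mul_pow] at this
    exact le_of_sq_le_sq this (mul_nonneg (l2_nonneg _) (l2_nonneg _))
  calc _ ≤ ∑ b, (‖(u - v) b‖ * ‖u b‖ + ‖(u - v) b‖ * ‖v b‖) := sum_le_sum fun b _ => h₁ b
    _ ≤ _ := by
      rw [sum_add_distrib, mul_add]
      exact add_le_add (cs _ _) (cs _ _)

/-- Only the part `χ` of `φ` on which the permutations disagree survives in the difference. Both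
permutations preserve its norm, and the triangle inequality gives the factor `2`, squared. -/
theorem l2_comp_symm_sub_sq_le [DecidableEq ι] (F G : Perm ι) (φ : ι → ℂ) :
    l2 (fun b => φ (F.symm b) - φ (G.symm b)) ^ 2 ≤
      4 * ∑ b with F b ≠ G b, ‖φ b‖ ^ 2 := by
  set χ : ι → ℂ := fun b => if F b ≠ G b then φ b else 0 with hχ
  have h₁ : (fun b => φ (F.symm b) - φ (G.symm b)) =
      (fun b => χ (F.symm b)) - fun b => χ (G.symm b) := by
    funext c
    simp only [Pi.sub_apply, hχ]
    by_cases hF : F (F.symm c) = G (F.symm c)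
    · have : G.symm c = F.symm c := by
        rw [Equiv.symm_apply_eq, ← hF, Equiv.apply_symm_apply]
      simp [this]
    · by_cases hG : F (G.symm c) = G (G.symm c)
      · have : F.symm c = G.symm c := by
          rw [Equiv.symm_apply_eq, hG, Equiv.apply_symm_apply]
        simp [this]
      · rw [if_pos hF, if_pos hG]
  have h₂ : l2 χ ^ 2 = ∑ b with F b ≠ G b, ‖φ b‖ ^ 2 := by
    rw [l2_sq, sum_filter]
    refine sum_congr rfl fun b _ => ?_
    by_cases h : F b ≠ G b <;> simp [hχ, h]
  have h₃ : l2 ((fun b => χ (F.symm b)) - fun b => χ (G.symm b)) ≤ 2 * l2 χ := by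
    refine (l2_sub_le _ _).trans_eq ?_
    rw [l2_comp_equiv, l2_comp_equiv, two_mul]
  rw [h₁, ← h₂]
  calc _ ≤ (2 * l2 χ) ^ 2 := pow_le_pow_left₀ (l2_nonneg _) h₃ 2
    _ = _ := by ring

end Norm

theorem l2_single : l2 (Pi.single 0 1 : State n d q w) = 1 := by
  rw [← sq_eq_sq₀ (l2_nonneg _) zero_le_one, l2_sq, Finset.sum_eq_single 0]
  · simp
  · intro b _ hb
    simp [Pi.single_eq_of_ne hb]
  · simp

theorem l2_applyOracle (F : Fin (d + 1) → Dom n d → Answer n d) (ψ : State n d q w) :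
    l2 (applyOracle F ψ) = l2 ψ :=
  l2_comp_equiv ψ (queryPerm q w F).symm

/-! ### Query mass -/

/-- The total weight with which the registers of the level `j` query the point `y`. -/
def levelMass (φ : State n d q w) (j : Fin (d + 1)) (y : Dom n d) : ℝ :=
  ∑ b, ∑ t, if (b.1 j t).1 = y then ‖φ b‖ ^ 2 else 0

theorem levelMass_nonneg (φ : State n d q w) (j : Fin (d + 1)) (y : Dom n d) :
    0 ≤ levelMass φ j y :=
  sum_nonneg fun _ _ => sum_nonneg fun _ _ => by split_ifs <;> positivity

theorem sum_levelMass (φ : State n d q w) (j : Fin (d + 1)) :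
    ∑ y, levelMass φ j y = q * l2 φ ^ 2 := by
  unfold levelMass
  rw [sum_comm, l2_sq, mul_sum]
  refine sum_congr rfl fun b _ => ?_
  rw [sum_comm]
  simp

/-- Markov's inequality for the query mass. -/
theorem card_heavy_mul_le (φ : State n d q w) (j : Fin (d + 1)) (θ : ℝ) :
    #{y | θ < levelMass φ j y} * θ ≤ q * l2 φ ^ 2 := by
  rw [← sum_levelMass φ j, ← nsmul_eq_mul, ← sum_const]
  calc _ ≤ ∑ y with θ < levelMass φ j y, levelMass φ j y :=
        sum_le_sum fun y hy => (by simpa using hy : θ < levelMass φ j y).le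
    _ ≤ _ := sum_le_sum_of_subset_of_nonneg (subset_univ _) fun y _ _ => levelMass_nonneg φ j y

/-- After the layer `k`, a point on a later level that depends on the path of `x` has query mass
above the threshold `θ`. -/
def Hit (ω : Sample n d) (θ : ℝ) (φ : State n d q w) (k : ℕ) (x : Bits n) : Prop :=
  ∃ j : Fin (d + 1), k < j ∧
    (θ < levelMass φ j (pathPoint ω j x) ∨ θ < levelMass φ j (backPoint ω j x))

-- A basis state on which the oracles disagree has a query register at an exceptional point of a
-- path outside `T`. There are `2 ^ n` paths, `d + 1` levels and two points for each, all of mass at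
-- most `θ` since every hit path lies in `T`.
open scoped Classical in
theorem l2_applyOracle_sub_le {ω : Sample n d} (hω : IsGood ω) (f : Bits n → Bits n) {θ : ℝ}
    (hθ : 0 ≤ θ) (φ : State n d q w) {k : ℕ} (hk : k < d) {T : Finset (Bits n)}
    (hT : ∀ x, Hit ω θ φ k x → x ∈ T) :
    l2 (applyOracle (shuffling (trueLevels ω) f) φ - applyOracle (simOracle ω f T k) φ) ≤
      2 * √(2 ^ n * (2 * (d + 1)) * θ) := by
  set J : Finset (Fin (d + 1)) := univ.filter fun j => k < (j : ℕ) with hJ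
  set F := queryPerm q w (shuffling (trueLevels ω) f) with hF
  set G := queryPerm q w (simOracle ω f T k) with hG
  have h₁ : l2 (applyOracle (shuffling (trueLevels ω) f) φ - applyOracle (simOracle ω f T k) φ) ^ 2
      ≤ 4 * ∑ b with F b ≠ G b, ‖φ b‖ ^ 2 := l2_comp_symm_sub_sq_le F G φ
  have h₂ : ∀ x ∉ T, ∀ j : Fin (d + 1), k < (j : ℕ) →
      levelMass φ j (pathPoint ω j x) + levelMass φ j (backPoint ω j x) ≤ 2 * θ := by
    intro x hx j hj
    have : ¬ Hit ω θ φ k x := fun h => hx (hT x h)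
    unfold Hit at this
    push Not at this
    have := this j hj
    linarith [this.1, this.2]
  have h₃ : ∀ b, F b ≠ G b → ‖φ b‖ ^ 2 ≤ ∑ x with x ∉ T, ∑ j ∈ J,
      ∑ t, ((if (b.1 j t).1 = pathPoint ω j x then ‖φ b‖ ^ 2 else 0) +
        (if (b.1 j t).1 = backPoint ω j x then ‖φ b‖ ^ 2 else 0)) := by
    intro b hb
    obtain ⟨x, hx, j, hj, t, ht⟩ : ∃ x ∉ T, ∃ j : Fin (d + 1), k < (j : ℕ) ∧ ∃ t,
        (b.1 j t).1 = pathPoint ω j x ∨ (b.1 j t).1 = backPoint ω j x := by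
      by_contra! hcon
      apply hb
      simp only [hF, hG, queryPerm, Equiv.coe_fn_mk]
      refine Prod.ext ?_ rfl
      funext j t
      refine Prod.ext rfl ?_
      dsimp only
      rw [simOracle_eq_shuffling hω f T k j _ (fun hj x hx => (hcon x hx j hj t).1)
        (fun hj x hx => (hcon x hx j hj t).2) hk]
    have nn : ∀ (x : Bits n) (j : Fin (d + 1)) (t : Fin q),
        0 ≤ (if (b.1 j t).1 = pathPoint ω j x then ‖φ b‖ ^ 2 else 0) +
          (if (b.1 j t).1 = backPoint ω j x then ‖φ b‖ ^ 2 else 0) := by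
      intro x j t
      split_ifs <;> positivity
    calc ‖φ b‖ ^ 2 ≤ (if (b.1 j t).1 = pathPoint ω j x then ‖φ b‖ ^ 2 else 0) +
          (if (b.1 j t).1 = backPoint ω j x then ‖φ b‖ ^ 2 else 0) := by
          rcases ht with ht | ht
          · rw [if_pos ht]; split_ifs <;> simp
          · rw [if_pos ht]; split_ifs <;> simp
      _ ≤ _ := single_le_sum (f := fun t => (if (b.1 j t).1 = pathPoint ω j x then ‖φ b‖ ^ 2 else 0)
          + (if (b.1 j t).1 = backPoint ω j x then ‖φ b‖ ^ 2 else 0)) (fun t _ => nn x j t)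
          (mem_univ t)
      _ ≤ _ := single_le_sum (f := fun j => ∑ t, ((if (b.1 j t).1 = pathPoint ω j x
          then ‖φ b‖ ^ 2 else 0) + (if (b.1 j t).1 = backPoint ω j x then ‖φ b‖ ^ 2 else 0)))
          (fun j _ => sum_nonneg fun t _ => nn x j t) (mem_filter.2 ⟨mem_univ j, hj⟩ : j ∈ J)
      _ ≤ _ := single_le_sum (f := fun x => ∑ j ∈ J, ∑ t,
          ((if (b.1 j t).1 = pathPoint ω j x
          then ‖φ b‖ ^ 2 else 0) + (if (b.1 j t).1 = backPoint ω j x then ‖φ b‖ ^ 2 else 0)))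
          (fun x _ => sum_nonneg fun j _ => sum_nonneg fun t _ => nn x j t)
          (mem_filter.2 ⟨mem_univ x, hx⟩)
  have h₄ : ∑ b with F b ≠ G b, ‖φ b‖ ^ 2 ≤ 2 ^ n * (2 * (d + 1)) * θ := by
    calc _ ≤ ∑ b, ∑ x with x ∉ T, ∑ j ∈ J,
          ∑ t, ((if (b.1 j t).1 = pathPoint ω j x then ‖φ b‖ ^ 2 else 0) +
          (if (b.1 j t).1 = backPoint ω j x then ‖φ b‖ ^ 2 else 0)) := by
          rw [sum_filter]
          refine sum_le_sum fun b _ => ?_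
          split_ifs with hb
          · exact h₃ b hb
          · refine sum_nonneg fun x _ => sum_nonneg fun j _ => sum_nonneg fun t _ => ?_
            split_ifs <;> positivity
      _ = ∑ x with x ∉ T, ∑ j ∈ J,
          (levelMass φ j (pathPoint ω j x) + levelMass φ j (backPoint ω j x)) := by
          rw [sum_comm]
          refine sum_congr rfl fun x _ => ?_
          rw [sum_comm]
          refine sum_congr rfl fun j _ => ?_
          unfold levelMass
          rw [← sum_add_distrib]
          exact sum_congr rfl fun b _ => sum_add_distrib
      _ ≤ ∑ x with x ∉ T, ∑ j ∈ J, 2 * θ :=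
          sum_le_sum fun x hx => sum_le_sum fun j hj =>
            h₂ x (mem_filter.1 hx).2 j (mem_filter.1 hj).2
      _ ≤ ∑ x : Bits n, ∑ j : Fin (d + 1), 2 * θ := by
          refine (sum_le_sum_of_subset_of_nonneg (subset_univ _) fun x _ _ =>
            sum_nonneg fun j _ => by positivity).trans (sum_le_sum fun x _ => ?_)
          exact sum_le_sum_of_subset_of_nonneg (subset_univ _) fun j _ _ => by positivity
      _ = _ := by
          simp only [sum_const, card_univ, Fintype.card_pi, ZMod.card, prod_const, Fintype.card_fin,
            nsmul_eq_mul]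
          push_cast
          ring
  refine le_of_sq_le_sq ?_ (by positivity)
  rw [mul_pow, Real.sq_sqrt (by positivity)]
  linarith

/-! ### The simulation of a circuit -/

open scoped Classical in
/-- The states of the simulation of a circuit, and the sets of the `x` whose paths are already
found. -/
def simRun (C : Circuit n d q w) (ω : Sample n d) (f : Bits n → Bits n) (θ : ℝ) :
    (k : ℕ) → k ≤ d → State n d q w × Finset (Bits n)
  | 0, _ => (Pi.single 0 1, ∅)
  | k + 1, h =>
      let φ := (C.layer ⟨k, h⟩ : Matrix (Basis n d q w) (Basis n d q w) ℂ).mulVec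
        (simRun C ω f θ k (Nat.le_of_succ_le h)).1
      let T := (simRun C ω f θ k (Nat.le_of_succ_le h)).2 ∪ univ.filter (Hit ω θ φ k)
      (applyOracle (simOracle ω f T k) φ, T)

/-- The state to which the oracle is applied after the layer `k` of the simulation. -/
def simQuery (C : Circuit n d q w) (ω : Sample n d) (f : Bits n → Bits n) (θ : ℝ) (k : ℕ)
    (h : k + 1 ≤ d) : State n d q w :=
  (C.layer ⟨k, h⟩ : Matrix (Basis n d q w) (Basis n d q w) ℂ).mulVec
    (simRun C ω f θ k (Nat.le_of_succ_le h)).1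

open scoped Classical in
theorem simRun_succ_snd (C : Circuit n d q w) (ω : Sample n d) (f : Bits n → Bits n) (θ : ℝ)
    (k : ℕ) (h : k + 1 ≤ d) : (simRun C ω f θ (k + 1) h).2 =
      (simRun C ω f θ k (Nat.le_of_succ_le h)).2 ∪
        univ.filter (Hit ω θ (simQuery C ω f θ k h) k) := rfl

theorem simRun_succ_fst (C : Circuit n d q w) (ω : Sample n d) (f : Bits n → Bits n) (θ : ℝ)
    (k : ℕ) (h : k + 1 ≤ d) : (simRun C ω f θ (k + 1) h).1 =
      applyOracle (simOracle ω f (simRun C ω f θ (k + 1) h).2 k) (simQuery C ω f θ k h) := rfl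

/-- The `x` whose paths are found in the simulation of a circuit. -/
def simFound (C : Circuit n d q w) (ω : Sample n d) (f : Bits n → Bits n) (θ : ℝ) :
    Finset (Bits n) :=
  (simRun C ω f θ d le_rfl).2

/-- The state at the end of the simulation of a circuit. -/
def simFinal (C : Circuit n d q w) (ω : Sample n d) (f : Bits n → Bits n) (θ : ℝ) :
    State n d q w :=
  (C.final : Matrix (Basis n d q w) (Basis n d q w) ℂ).mulVec (simRun C ω f θ d le_rfl).1

/-- The probability of the outcome `z` in the simulation of a circuit. -/
def simProb (C : Circuit n d q w) (ω : Sample n d) (f : Bits n → Bits n) (θ : ℝ)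
    (z : Basis n d q w) : ℝ :=
  ‖simFinal C ω f θ z‖ ^ 2

theorem l2_simRun (C : Circuit n d q w) (ω : Sample n d) (f : Bits n → Bits n) (θ : ℝ) (k : ℕ)
    (h : k ≤ d) : l2 (simRun C ω f θ k h).1 = 1 := by
  induction k with
  | zero => exact l2_single
  | succ k ih => rw [simRun_succ_fst, l2_applyOracle, simQuery, l2_mulVec, ih]

theorem l2_simQuery (C : Circuit n d q w) (ω : Sample n d) (f : Bits n → Bits n) (θ : ℝ) (k : ℕ)
    (h : k + 1 ≤ d) : l2 (simQuery C ω f θ k h) = 1 := by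
  rw [simQuery, l2_mulVec, l2_simRun]

theorem l2_stateAfter (C : Circuit n d q w) (F : Fin (d + 1) → Dom n d → Answer n d) (k : ℕ)
    (h : k ≤ d) : l2 (C.stateAfter F k h) = 1 := by
  induction k with
  | zero => exact l2_single
  | succ k ih => rw [Circuit.stateAfter, l2_applyOracle, l2_mulVec, ih]

theorem l2_finalState (C : Circuit n d q w) (F : Fin (d + 1) → Dom n d → Answer n d) :
    l2 (C.finalState F) = 1 := by
  rw [Circuit.finalState, l2_mulVec, l2_stateAfter]

theorem l2_simFinal (C : Circuit n d q w) (ω : Sample n d) (f : Bits n → Bits n) (θ : ℝ) :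
    l2 (simFinal C ω f θ) = 1 := by
  rw [simFinal, l2_mulVec, l2_simRun]

theorem sum_outcomeProb (C : Circuit n d q w) (F : Fin (d + 1) → Dom n d → Answer n d) :
    ∑ z, C.outcomeProb F z = 1 := by
  have := l2_sq (C.finalState F)
  rw [l2_finalState] at this
  simpa [Circuit.outcomeProb] using this.symm

theorem sum_simProb (C : Circuit n d q w) (ω : Sample n d) (f : Bits n → Bits n) (θ : ℝ) :
    ∑ z, simProb C ω f θ z = 1 := by
  have := l2_sq (simFinal C ω f θ)
  rw [l2_simFinal] at this
  simpa [simProb] using this.symm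

theorem simProb_nonneg (C : Circuit n d q w) (ω : Sample n d) (f : Bits n → Bits n) (θ : ℝ)
    (z : Basis n d q w) : 0 ≤ simProb C ω f θ z := sq_nonneg _

theorem outcomeProb_nonneg (C : Circuit n d q w) (F : Fin (d + 1) → Dom n d → Answer n d)
    (z : Basis n d q w) : 0 ≤ C.outcomeProb F z := sq_nonneg _

/-- The bound on the difference between a circuit and its simulation. -/
def simError (n d : ℕ) (θ : ℝ) : ℝ := d * (2 * √(2 ^ n * (2 * (d + 1)) * θ))

/-- Hybrid argument: layers and oracle calls preserve the norm, so the errors of the single calls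
add up. -/
theorem l2_stateAfter_sub_simRun_le (C : Circuit n d q w) {ω : Sample n d} (hω : IsGood ω)
    (f : Bits n → Bits n) {θ : ℝ} (hθ : 0 ≤ θ) (k : ℕ) (h : k ≤ d) :
    l2 (C.stateAfter (shuffling (trueLevels ω) f) k h - (simRun C ω f θ k h).1) ≤
      k * (2 * √(2 ^ n * (2 * (d + 1)) * θ)) := by
  induction k with
  | zero =>
    rw [show C.stateAfter (shuffling (trueLevels ω) f) 0 h - (simRun C ω f θ 0 h).1 = 0 from
      sub_self _]
    simp [l2]
  | succ k ih =>
    classical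
    set F := shuffling (trueLevels ω) f
    set ψ := C.stateAfter F k (Nat.le_of_succ_le h)
    set U := (C.layer ⟨k, h⟩ : Matrix (Basis n d q w) (Basis n d q w) ℂ) with hU
    -- The two oracles are compared on the simulated state, because hits are defined by its query
    -- masses.
    have e₁ : C.stateAfter F (k + 1) h - (simRun C ω f θ (k + 1) h).1 =
        applyOracle F (U.mulVec (ψ - (simRun C ω f θ k (Nat.le_of_succ_le h)).1)) +
        (applyOracle F (simQuery C ω f θ k h) - applyOracle
          (simOracle ω f (simRun C ω f θ (k + 1) h).2 k) (simQuery C ω f θ k h)) := by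
      rw [simRun_succ_fst, Matrix.mulVec_sub]
      funext b
      simp only [Circuit.stateAfter, Pi.sub_apply, Pi.add_apply, applyOracle, simQuery]
      ring
    rw [e₁]
    refine (l2_add_le _ _).trans ?_
    rw [l2_applyOracle, hU, l2_mulVec]
    have h₂ := l2_applyOracle_sub_le hω f hθ (simQuery C ω f θ k h) h
      (T := (simRun C ω f θ (k + 1) h).2) (by
        intro x hx
        rw [simRun_succ_snd]
        exact mem_union_right _ (mem_filter.2 ⟨mem_univ x, hx⟩))
    have := ih (Nat.le_of_succ_le h)
    push_cast
    linarith

theorem sum_abs_outcomeProb_sub_simProb_le (C : Circuit n d q w) {ω : Sample n d}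
    (hω : IsGood ω) (f : Bits n → Bits n) {θ : ℝ} (hθ : 0 ≤ θ) :
    ∑ z, |C.outcomeProb (shuffling (trueLevels ω) f) z - simProb C ω f θ z| ≤
      2 * simError n d θ := by
  refine (sum_abs_sq_sub_sq_le _ _).trans ?_
  rw [l2_finalState, l2_simFinal, Circuit.finalState, simFinal, ← Matrix.mulVec_sub, l2_mulVec]
  have := l2_stateAfter_sub_simRun_le C hω f hθ d le_rfl
  unfold simError
  linarith

/-! ### The shuffling of a uniformly random sample is uniformly random -/

/-- The permutation that a gauge transformation applies to the points in which paths enter the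
level `j`. -/
def prevGauge (g : Levels n d) : ℕ → Perm (Dom n d)
  | 0 => 1
  | j + 1 => if h : j < d then g ⟨j, h⟩ else 1

/-- The gauge transformation of samples that renames the points after every level. -/
def sampleGauge (g : Levels n d) : Perm (Sample n d) :=
  Equiv.prodCongr
    (Equiv.piCongrRight fun j => (Equiv.mulLeft (g j)).trans (Equiv.mulRight (prevGauge g j)⁻¹))
    (Equiv.piCongrRight fun _ => Equiv.piCongrRight fun j => g j)

theorem sampleGauge_fst (g : Levels n d) (ω : Sample n d) (j : Fin d) :
    (sampleGauge g ω).1 j = g j * ω.1 j * (prevGauge g j)⁻¹ := rfl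

theorem pathPoint_sampleGauge (g : Levels n d) (ω : Sample n d) {j : ℕ} (hj : j ≤ d)
    (x : Bits n) : pathPoint (sampleGauge g ω) j x = prevGauge g j (pathPoint ω j x) := by
  cases j with
  | zero => rfl
  | succ j =>
    have hj' : j < d := hj
    simp only [pathPoint, prevGauge, dif_pos hj']
    rfl

theorem trueLevels_sampleGauge (g : Levels n d) (ω : Sample n d) (j : Fin d) :
    trueLevels (sampleGauge g ω) j = g j * trueLevels ω j * (prevGauge g j)⁻¹ := by
  have hg : prevGauge g (j + 1) = g j := by simp [prevGauge]
  unfold trueLevels routed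
  have h₁ : (fun x => (sampleGauge g ω).1 j (pathPoint (sampleGauge g ω) j x)) =
      fun x => g j (ω.1 j (pathPoint ω j x)) := by
    funext x
    rw [sampleGauge_fst, pathPoint_sampleGauge g ω j.2.le]
    simp
  have h₂ : pathPoint (sampleGauge g ω) (j + 1) = fun x => g j (pathPoint ω (j + 1) x) := by
    funext x
    rw [pathPoint_sampleGauge g ω j.2, hg]
  rw [h₁, h₂, reroute_conj, sampleGauge_fst]
  group

/-- The gauge at the entrance of a level is the one at the exit of the level before, so `g` can be
recovered level by level. -/
theorem levelGauge_bijective (σ : Levels n d) :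
    Function.Bijective fun (g : Levels n d) (j : Fin d) => g j * σ j * (prevGauge g j)⁻¹ := by
  rw [← Finite.injective_iff_bijective]
  intro g g' h
  have key : ∀ j : ℕ, prevGauge g j = prevGauge g' j := by
    intro j
    induction j with
    | zero => rfl
    | succ j ih =>
      simp only [prevGauge]
      split_ifs with hj
      · have := congrFun h ⟨j, hj⟩
        simp only [ih] at this
        exact mul_right_cancel (mul_right_cancel this)
      · rfl
  funext j
  have := key (j + 1)
  simpa [prevGauge] using this

/-- A gauge transformation permutes the samples, so averaging over all of them changes nothing; for
a fixed sample, the transformed levels run through all families exactly once. Bad samples need no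
exception, since covariance holds for them too. -/
theorem expect_trueLevels (φ : Levels n d → ℝ) :
    𝔼 ω : Sample n d, φ (trueLevels ω) = 𝔼 σ, φ σ := by
  have h₁ : ∀ g : Levels n d, 𝔼 ω : Sample n d, φ (trueLevels ω) =
      𝔼 ω : Sample n d, φ fun j => g j * trueLevels ω j * (prevGauge g j)⁻¹ := by
    intro g
    refine (Fintype.expect_equiv (sampleGauge g) _ _ fun ω => ?_).symm
    congr 1
    funext j
    rw [trueLevels_sampleGauge]
  calc 𝔼 ω : Sample n d, φ (trueLevels ω)
      = 𝔼 _g : Levels n d, 𝔼 ω : Sample n d, φ (trueLevels ω) := by rw [Fintype.expect_const]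
    _ = 𝔼 g : Levels n d, 𝔼 ω : Sample n d,
          φ fun j => g j * trueLevels ω j * (prevGauge g j)⁻¹ := expect_congr rfl fun g _ => h₁ g
    _ = 𝔼 ω : Sample n d, 𝔼 g : Levels n d,
          φ fun j => g j * trueLevels ω j * (prevGauge g j)⁻¹ := expect_comm _ _ _
    _ = 𝔼 _ω : Sample n d, 𝔼 σ, φ σ := expect_congr rfl fun ω _ =>
          Fintype.expect_bijective _ (levelGauge_bijective (trueLevels ω)) _ _ fun _ => rfl
    _ = _ := by rw [Fintype.expect_const]

/-! ### Resampling -/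

section Resample

variable {ι κ α : Type*}

/-- The family `a`, with the entries in `R` from the index `k` on replaced by those of `c`. -/
def mix [DecidableEq ι] (k : ℕ) (R : Finset ι) (a c : ι → Fin d → α) : ι → Fin d → α :=
  fun x i => if x ∈ R ∧ k ≤ (i : ℕ) then c x i else a x i

theorem expect_univ_prod [Fintype ι] [Fintype κ] (φ : ι × κ → ℝ) :
    𝔼 p, φ p = 𝔼 i, 𝔼 j, φ (i, j) := by
  rw [← univ_product_univ, expect_product]

/-- Exchanging the selected entries between two independent families is an involution on pairs and
preserves the uniform distribution. -/
theorem expect_mix [Fintype ι] [DecidableEq ι] [Fintype α] [Nonempty α] (k : ℕ) (R : Finset ι)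
    (φ : (ι → Fin d → α) → ℝ) : 𝔼 a, φ a = 𝔼 a, 𝔼 c, φ (mix k R a c) := by
  let e : Perm ((ι → Fin d → α) × (ι → Fin d → α)) :=
    Function.Involutive.toPerm (fun p => (mix k R p.1 p.2, mix k R p.2 p.1)) (by
      intro p
      refine Prod.ext ?_ ?_ <;>
      · funext x i
        simp only [mix]
        split_ifs <;> rfl)
  have h := Fintype.expect_equiv e (fun p => φ (mix k R p.1 p.2)) (fun p => φ p.1) fun _ => rfl
  rw [expect_univ_prod, expect_univ_prod] at h
  rw [h]
  exact expect_congr rfl fun a _ => (Fintype.expect_const _).symm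

theorem expect_prod_apply [Fintype ι] [DecidableEq ι] [Fintype α] (g : ι → α → ℝ) :
    𝔼 c : ι → α, ∏ i, g i (c i) = ∏ i, 𝔼 v, g i v := by
  simp only [Fintype.expect_eq_sum_div_card]
  rw [prod_div_distrib, prod_univ_sum, Fintype.piFinset_univ, Fintype.card_pi]
  push_cast
  rfl

theorem expect_apply [Fintype ι] [DecidableEq ι] [Fintype α] [Nonempty α] (i : ι) (g : α → ℝ) :
    𝔼 c : ι → α, g (c i) = 𝔼 v, g v := by
  have h := expect_prod_apply (ι := ι) fun j => if j = i then g else fun _ => (1 : ℝ)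
  have h₁ : ∀ c : ι → α, ∏ j, (if j = i then g else fun _ => (1 : ℝ)) (c j) = g (c i) := by
    intro c
    rw [prod_eq_single i]
    · simp
    · intro j _ hj; simp [hj]
    · simp
  simp only [h₁] at h
  rw [h, prod_eq_single i]
  · simp
  · intro j _ hj; simp [hj]
  · simp

theorem expect_indicator_eq [Fintype α] [DecidableEq α] (P : α → Prop) [DecidablePred P] :
    𝔼 v, (if P v then (1 : ℝ) else 0) = #{v | P v} / Fintype.card α := by
  rw [Fintype.expect_eq_sum_div_card, sum_boole]

theorem expect_indicator_eq_apply [Fintype ι] [DecidableEq ι] [Fintype α] [DecidableEq α]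
    [Nonempty α] (h : (ι → Fin d → α) → α) (x : ι) (j : Fin d)
    (hh : ∀ a c, h (mix j {x} a c) = h a) :
    𝔼 a, (if h a = a x j then (1 : ℝ) else 0) = 1 / Fintype.card α := by
  rw [expect_mix (j : ℕ) {x}]
  have h₁ : ∀ a, 𝔼 c, (if h (mix j {x} a c) = mix j {x} a c x j then (1 : ℝ) else 0) =
      1 / Fintype.card α := by
    intro a
    have h₂ : ∀ c : ι → Fin d → α, mix (j : ℕ) {x} a c x j = c x j := fun c => by simp [mix]
    simp only [hh, h₂]
    rw [expect_apply x fun v : Fin d → α => if h a = v j then (1 : ℝ) else 0,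
      expect_apply j fun v : α => if h a = v then (1 : ℝ) else 0, expect_indicator_eq]
    simp [filter_eq]
  simp only [h₁]
  exact Fintype.expect_const _

end Resample

/-! ### Bad samples are rare -/

theorem card_dom : (Fintype.card (Dom n d) : ℝ) = 2 ^ ((d + 2) * n) := by
  simp [ZMod.card]

-- Rerouting fails only if a path point coincides with something independent of it: a point of
-- another path on the same level, or the base image of an entry point. The bound sums these two
-- kinds of coincidence over all levels and ordered pairs.
open scoped Classical in
theorem expect_not_isGood_le :
    𝔼 ω : Sample n d, (if IsGood ω then (0 : ℝ) else 1) ≤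
      2 * d * 4 ^ n / 2 ^ ((d + 2) * n) := by
  have h₁ : ∀ ω : Sample n d, (if IsGood ω then (0 : ℝ) else 1) ≤
      ∑ j : Fin d, ∑ x : Bits n, ∑ y : Bits n, ((if x ≠ y ∧ ω.2 x j = ω.2 y j then 1 else 0) +
        (if ω.1 j (pathPoint ω j x) = ω.2 y j then 1 else 0)) := by
    intro ω
    have nn : ∀ (j : Fin d) (x y : Bits n),
        (0 : ℝ) ≤ (if x ≠ y ∧ ω.2 x j = ω.2 y j then 1 else 0) +
        (if ω.1 j (pathPoint ω j x) = ω.2 y j then 1 else 0) := by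
      intro j x y; split_ifs <;> norm_num
    split_ifs with hω
    · exact sum_nonneg fun j _ => sum_nonneg fun x _ => sum_nonneg fun y _ => nn j x y
    · obtain ⟨j, x, y, h⟩ : ∃ (j : Fin d) (x y : Bits n), (x ≠ y ∧ ω.2 x j = ω.2 y j) ∨
          ω.1 j (pathPoint ω j x) = ω.2 y j := by
        by_contra! hcon
        apply hω
        have hright : ∀ j : Fin d, Function.Injective (pathPoint ω (j + 1)) := by
          intro j x y hxy
          by_contra hne
          exact (hcon j x y).1 hne (by simpa [pathPoint] using hxy)
        intro j
        refine ⟨(ω.1 j).injective.comp ?_, hright j, fun x y hxy => ?_⟩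
        · obtain ⟨j, hj⟩ := j
          cases j with
          | zero => exact pad_injective
          | succ j => exact hright ⟨j, by omega⟩
        · exact (hcon j x y).2 (by simpa [pathPoint] using hxy)
      have h₀ : (1 : ℝ) ≤ (if x ≠ y ∧ ω.2 x j = ω.2 y j then 1 else 0) +
          (if ω.1 j (pathPoint ω j x) = ω.2 y j then 1 else 0) := by
        rcases h with h | h
        · rw [if_pos h]; split_ifs <;> norm_num
        · rw [if_pos h]; split_ifs <;> norm_num
      refine h₀.trans ?_
      refine (single_le_sum (f := fun y => _) (fun y _ => nn j x y) (mem_univ y)).trans ?_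
      refine (single_le_sum (f := fun x => ∑ y : Bits n, _)
        (fun x _ => sum_nonneg fun y _ => nn j x y) (mem_univ x)).trans ?_
      exact single_le_sum (f := fun j => ∑ x : Bits n, ∑ y : Bits n, _)
        (fun j _ => sum_nonneg fun x _ => sum_nonneg fun y _ => nn j x y) (mem_univ j)
  have h₂ : ∀ (j : Fin d) (x y : Bits n),
      𝔼 ω : Sample n d, (if x ≠ y ∧ ω.2 x j = ω.2 y j then (1 : ℝ) else 0) ≤
        1 / 2 ^ ((d + 2) * n) := by
    intro j x y
    by_cases hxy : x = y
    · simp [hxy]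
    · rw [expect_univ_prod]
      refine expect_le univ_nonempty fun β _ => ?_
      simp only [ne_eq, hxy, not_false_eq_true, true_and]
      rw [expect_indicator_eq_apply (fun a => a x j) y j fun a c => by simp [mix, hxy], card_dom]
  have h₃ : ∀ (j : Fin d) (x y : Bits n),
      𝔼 ω : Sample n d, (if ω.1 j (pathPoint ω j x) = ω.2 y j then (1 : ℝ) else 0) ≤
        1 / 2 ^ ((d + 2) * n) := by
    intro j x y
    rw [expect_univ_prod]
    refine expect_le univ_nonempty fun β _ => ?_
    -- The entry point of level `j` is fixed or has index `j - 1`, so redrawing from index `j` on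
    -- does not touch it, even for `x = y`.
    rw [expect_indicator_eq_apply (fun a => β j (pathPoint (β, a) j x)) y j fun a c => ?_, card_dom]
    congr 1
    obtain ⟨j, hj⟩ := j
    cases j with
    | zero => rfl
    | succ j => simp [pathPoint, mix]
  calc _ ≤ 𝔼 ω : Sample n d, ∑ j : Fin d, ∑ x : Bits n, ∑ y : Bits n,
        ((if x ≠ y ∧ ω.2 x j = ω.2 y j then (1 : ℝ) else 0) +
        (if ω.1 j (pathPoint ω j x) = ω.2 y j then 1 else 0)) :=
        expect_le_expect fun ω _ => h₁ ω
    _ = ∑ j : Fin d, ∑ x : Bits n, ∑ y : Bits n,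
        (𝔼 ω : Sample n d, (if x ≠ y ∧ ω.2 x j = ω.2 y j then (1 : ℝ) else 0) +
        𝔼 ω : Sample n d, (if ω.1 j (pathPoint ω j x) = ω.2 y j then (1 : ℝ) else 0)) := by
        rw [expect_sum_comm]
        refine sum_congr rfl fun j _ => ?_
        rw [expect_sum_comm]
        refine sum_congr rfl fun x _ => ?_
        rw [expect_sum_comm]
        exact sum_congr rfl fun y _ => expect_add_distrib _ _ _
    _ ≤ ∑ _j : Fin d, ∑ _x : Bits n, ∑ _y : Bits n,
        ((1 : ℝ) / 2 ^ ((d + 2) * n) + 1 / 2 ^ ((d + 2) * n)) :=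
        sum_le_sum fun j _ => sum_le_sum fun x _ => sum_le_sum fun y _ =>
          add_le_add (h₂ j x y) (h₃ j x y)
    _ = _ := by
        simp only [sum_const, card_univ, Fintype.card_pi, ZMod.card, prod_const, Fintype.card_fin,
          nsmul_eq_mul]
        rw [show (4 : ℝ) = 2 * 2 by norm_num, mul_pow]
        push_cast
        ring

/-! ### Few paths are found in the simulation of a circuit -/

theorem pathPoint_congr {ω ω' : Sample n d} {R : Finset (Bits n)} {K : ℕ}
    (h₂ : ∀ x (i : Fin d), x ∉ R ∨ (i : ℕ) < K → ω.2 x i = ω'.2 x i) {j : ℕ} {x : Bits n}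
    (hx : x ∉ R ∨ j ≤ K) : pathPoint ω j x = pathPoint ω' j x := by
  cases j with
  | zero => rfl
  | succ j =>
    simp only [pathPoint]
    split_ifs with hj
    · exact h₂ x _ (hx.imp_right fun h => h)
    · rfl

theorem routed_congr {ω ω' : Sample n d} (h₁ : ω.1 = ω'.1) {T : Finset (Bits n)} {j : Fin d}
    (hp : ∀ x ∈ T, pathPoint ω j x = pathPoint ω' j x)
    (hq : ∀ x ∈ T, pathPoint ω (j + 1) x = pathPoint ω' (j + 1) x) :
    routed ω T j = routed ω' T j := by
  unfold routed
  rw [h₁]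
  congr 1
  exact reroute_congr (fun x hx => by rw [hp x hx]) hq

theorem partialAnswer_congr {ω ω' : Sample n d} {f f' : Bits n → Bits n} {T : Finset (Bits n)}
    (hp : ∀ x ∈ T, pathPoint ω d x = pathPoint ω' d x) (hf : ∀ x ∈ T, f x = f' x) (y : Dom n d) :
    partialAnswer ω f T y = partialAnswer ω' f' T y := by
  classical
  -- The predicates are equal as functions, so `choose` selects the same witness; injectivity of the
  -- paths is not needed.
  have h : (fun x => x ∈ T ∧ pathPoint ω d x = y) = fun x => x ∈ T ∧ pathPoint ω' d x = y := by
    funext x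
    by_cases hx : x ∈ T
    · simp [hx, hp x hx]
    · simp [hx]
  unfold partialAnswer
  by_cases hex : ∃ x ∈ T, pathPoint ω d x = y
  · have hex' : ∃ x ∈ T, pathPoint ω' d x = y := by
      obtain ⟨x, hx⟩ := hex
      exact ⟨x, (congrFun h x).mp hx⟩
    rw [dif_pos hex, dif_pos hex', hf _ hex.choose_spec.1]
    congr 3
    simp only [h]
  · have hex' : ¬ ∃ x ∈ T, pathPoint ω' d x = y := by
      rintro ⟨x, hx⟩
      exact hex ⟨x, (congrFun h x).mpr hx⟩
    rw [dif_neg hex, dif_neg hex']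

theorem simOracle_congr_function {ω : Sample n d} {f f' : Bits n → Bits n} {T : Finset (Bits n)}
    (hf : ∀ x ∈ T, f x = f' x) (k : ℕ) : simOracle ω f T k = simOracle ω f' T k := by
  funext j y
  unfold simOracle
  split_ifs
  · rfl
  · rfl
  · exact partialAnswer_congr (fun _ _ => rfl) hf y

/-- The samples may differ only in entries of paths in `R` with index at least `K`. Levels up to `k`
use entries of index at most `k < K`, and later levels use only paths in `T`, which avoids `R`. -/
theorem simOracle_congr_sample {ω ω' : Sample n d} (h₁ : ω.1 = ω'.1) {R : Finset (Bits n)} {K : ℕ}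
    (h₂ : ∀ x (i : Fin d), x ∉ R ∨ (i : ℕ) < K → ω.2 x i = ω'.2 x i) (f : Bits n → Bits n)
    {T : Finset (Bits n)} (hT : Disjoint R T) {k : ℕ} (hk : k < K) :
    simOracle ω f T k = simOracle ω' f T k := by
  have hR : ∀ x ∈ T, x ∉ R := fun x hx hxR => (Finset.disjoint_left.1 hT) hxR hx
  funext j y
  unfold simOracle
  split_ifs with hj hjk
  · rw [routed_congr h₁ (fun x _ => pathPoint_congr h₂ (Or.inr (by simp only; omega)))
      fun x _ => pathPoint_congr h₂ (Or.inr (by simp only; omega))]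
  · rw [routed_congr h₁ (fun x hx => pathPoint_congr h₂ (Or.inl (hR x hx)))
      fun x hx => pathPoint_congr h₂ (Or.inl (hR x hx))]
  · exact partialAnswer_congr (fun x hx => pathPoint_congr h₂ (Or.inl (hR x hx)))
      (fun _ _ => rfl) y

theorem hit_congr {ω ω' : Sample n d} (h₁ : ω.1 = ω'.1) {x : Bits n}
    (h₂ : ∀ i, ω.2 x i = ω'.2 x i) (θ : ℝ) (φ : State n d q w) (k : ℕ) :
    Hit ω θ φ k x ↔ Hit ω' θ φ k x := by
  have hp : ∀ j, pathPoint ω j x = pathPoint ω' j x := by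
    intro j
    cases j with
    | zero => rfl
    | succ j => simp [pathPoint, h₂]
  have hb : ∀ j, backPoint ω j x = backPoint ω' j x := by
    intro j
    simp only [backPoint, h₁, h₂, hp]
  simp only [Hit, hp, hb]

/-- The found set only grows, so agreement on the last one covers all earlier calls. Thus the found
set is a certificate for the whole run. -/
theorem simRun_congr_function (C : Circuit n d q w) (ω : Sample n d) {f f' : Bits n → Bits n}
    (θ : ℝ) (k : ℕ) (h : k ≤ d) (hf : ∀ x ∈ (simRun C ω f θ k h).2, f x = f' x) :
    simRun C ω f θ k h = simRun C ω f' θ k h := by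
  classical
  induction k with
  | zero => rfl
  | succ k ih =>
    have ih' := ih (Nat.le_of_succ_le h) fun x hx => hf x (by
      rw [simRun_succ_snd]; exact mem_union_left _ hx)
    have hφ : simQuery C ω f θ k h = simQuery C ω f' θ k h := by
      unfold simQuery; rw [ih']
    have hT : (simRun C ω f θ (k + 1) h).2 = (simRun C ω f' θ (k + 1) h).2 := by
      rw [simRun_succ_snd, simRun_succ_snd, ih', hφ]
    refine Prod.ext ?_ hT
    rw [simRun_succ_fst, simRun_succ_fst, ← hT, ← hφ, simOracle_congr_function hf]

/-- The first `K` calls cannot see the entries of index at least `K` of paths that are not found.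
Disjointness is required in both runs: it settles membership in the found sets for `R`, and outside
`R` the hits agree. -/
theorem simRun_congr_sample (C : Circuit n d q w) {ω ω' : Sample n d} (f : Bits n → Bits n)
    (θ : ℝ) (h₁ : ω.1 = ω'.1) {R : Finset (Bits n)} {K : ℕ}
    (h₂ : ∀ x (i : Fin d), x ∉ R ∨ (i : ℕ) < K → ω.2 x i = ω'.2 x i) (k : ℕ) (h : k ≤ d)
    (hk : k ≤ K) (hR : Disjoint R (simRun C ω f θ k h).2)
    (hR' : Disjoint R (simRun C ω' f θ k h).2) :
    simRun C ω f θ k h = simRun C ω' f θ k h := by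
  classical
  induction k with
  | zero => rfl
  | succ k ih =>
    have ih' := ih (Nat.le_of_succ_le h) (Nat.le_of_succ_le hk)
      (hR.mono_right (by rw [simRun_succ_snd]; exact subset_union_left))
      (hR'.mono_right (by rw [simRun_succ_snd]; exact subset_union_left))
    have hφ : simQuery C ω f θ k h = simQuery C ω' f θ k h := by
      unfold simQuery; rw [ih']
    have hT : (simRun C ω f θ (k + 1) h).2 = (simRun C ω' f θ (k + 1) h).2 := by
      ext x
      by_cases hx : x ∈ R
      · exact iff_of_false (Finset.disjoint_left.1 hR hx) (Finset.disjoint_left.1 hR' hx)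
      · rw [simRun_succ_snd, simRun_succ_snd, ih', hφ]
        simp only [mem_union, mem_filter, mem_univ, true_and,
          hit_congr h₁ (fun i => h₂ x i (Or.inl hx))]
    refine Prod.ext ?_ hT
    rw [simRun_succ_fst, simRun_succ_fst, ← hT, ← hφ, simOracle_congr_sample h₁ h₂ f hR hk]

theorem simRun_mono (C : Circuit n d q w) (ω : Sample n d) (f : Bits n → Bits n) (θ : ℝ) (k : ℕ)
    (h : k + 1 ≤ d) : (simRun C ω f θ k (Nat.le_of_succ_le h)).2 ⊆ (simRun C ω f θ (k + 1) h).2 := by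
  rw [simRun_succ_snd]
  exact subset_union_left

/-- On a level `j > k` the path point is the entry of index `j - 1 ≥ k` and the back point comes
from the entry of index `j`, so both are redrawn. On the last level the back point is the path
point. -/
theorem hit_mix {β : Levels n d} {k : ℕ} {R : Finset (Bits n)} {a c : Bits n → Fin d → Dom n d}
    {θ : ℝ} {φ : State n d q w} {x : Bits n} (hx : x ∈ R) (h : Hit (β, mix k R a c) θ φ k x) :
    ∃ i : Fin d, θ < levelMass φ i.succ (c x i) ∨
      θ < levelMass φ i.castSucc ((β i).symm (c x i)) := by
  obtain ⟨j, hj, h⟩ := h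
  have hpath : θ < levelMass φ j (pathPoint (β, mix k R a c) j x) →
      ∃ i : Fin d, θ < levelMass φ i.succ (c x i) ∨
        θ < levelMass φ i.castSucc ((β i).symm (c x i)) := by
    intro h
    obtain ⟨i, rfl⟩ := Fin.exists_succ_eq.2 (show j ≠ 0 by rintro rfl; simp at hj)
    refine ⟨i, Or.inl ?_⟩
    have hi : k ≤ (i : ℕ) := by simpa [Nat.lt_succ_iff] using hj
    have : pathPoint (β, mix k R a c) (i.succ : Fin (d + 1)) x = c x i := by
      simp [pathPoint, mix, hx, hi]
    rwa [this] at h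
  rcases h with h | h
  · exact hpath h
  · by_cases hjd : (j : ℕ) < d
    · refine ⟨⟨j, hjd⟩, Or.inr ?_⟩
      have : backPoint (β, mix k R a c) j x = (β ⟨j, hjd⟩).symm (c x ⟨j, hjd⟩) := by
        simp [backPoint, hjd, mix, hx, hj.le]
      rw [this] at h
      exact h
    · rw [backPoint, dif_neg hjd] at h
      exact hpath h

open scoped Classical in
theorem expect_heavy_le {φ : State n d q w} {θ L : ℝ} (β : Levels n d)
    (hL : ∀ j, (#{y | θ < levelMass φ j y} : ℝ) ≤ L) :
    𝔼 v : Fin d → Dom n d, (if ∃ i : Fin d, θ < levelMass φ i.succ (v i) ∨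
      θ < levelMass φ i.castSucc ((β i).symm (v i)) then (1 : ℝ) else 0) ≤
      2 * d * L / 2 ^ ((d + 2) * n) := by
  have hone : ∀ (i : Fin d) (j : Fin (d + 1)) (e : Perm (Dom n d)),
      𝔼 v : Fin d → Dom n d, (if θ < levelMass φ j (e (v i)) then (1 : ℝ) else 0) ≤
        L / 2 ^ ((d + 2) * n) := by
    intro i j e
    rw [expect_apply i fun y => if θ < levelMass φ j (e y) then (1 : ℝ) else 0,
      Fintype.expect_equiv e _ (fun y => if θ < levelMass φ j y then (1 : ℝ) else 0) fun _ => rfl,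
      expect_indicator_eq, card_dom]
    exact div_le_div_of_nonneg_right (hL j) (by positivity)
  calc _ ≤ 𝔼 v : Fin d → Dom n d, ∑ i : Fin d,
        ((if θ < levelMass φ i.succ ((1 : Perm (Dom n d)) (v i)) then (1 : ℝ) else 0) +
          (if θ < levelMass φ i.castSucc ((β i).symm (v i)) then (1 : ℝ) else 0)) := by
        refine expect_le_expect fun v _ => ?_
        have nn : ∀ i : Fin d, (0 : ℝ) ≤
            (if θ < levelMass φ i.succ ((1 : Perm (Dom n d)) (v i)) then (1 : ℝ) else 0) +
            (if θ < levelMass φ i.castSucc ((β i).symm (v i)) then (1 : ℝ) else 0) := by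
          intro i; split_ifs <;> norm_num
        split_ifs with h
        · obtain ⟨i, h⟩ := h
          refine le_trans ?_ (single_le_sum (f := fun i => _) (fun i _ => nn i) (mem_univ i))
          rcases h with h | h
          · rw [if_pos (show θ < levelMass φ i.succ ((1 : Perm (Dom n d)) (v i)) from h)]
            split_ifs <;> norm_num
          · rw [if_pos h]; split_ifs <;> norm_num
        · exact sum_nonneg fun i _ => nn i
    _ = ∑ i : Fin d, (𝔼 v : Fin d → Dom n d,
          (if θ < levelMass φ i.succ ((1 : Perm (Dom n d)) (v i)) then (1 : ℝ) else 0) +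
        𝔼 v : Fin d → Dom n d,
          (if θ < levelMass φ i.castSucc ((β i).symm (v i)) then (1 : ℝ) else 0)) := by
        rw [expect_sum_comm]
        exact sum_congr rfl fun i _ => expect_add_distrib _ _ _
    _ ≤ ∑ _i : Fin d, (L / 2 ^ ((d + 2) * n) + L / 2 ^ ((d + 2) * n)) :=
        sum_le_sum fun i _ => add_le_add (hone i i.succ 1) (hone i i.castSucc (β i).symm)
    _ = _ := by
        simp only [sum_const, card_univ, Fintype.card_fin, nsmul_eq_mul]
        ring

-- The later entries of the paths in `R` are independent of the state queried at call `k`, and each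
-- path has to meet one of few heavy points.
open scoped Classical in
theorem expect_subset_found_le (C : Circuit n d q w) (f : Bits n → Bits n) {θ L : ℝ}
    (hL : ∀ φ : State n d q w, l2 φ = 1 → ∀ j, (#{y | θ < levelMass φ j y} : ℝ) ≤ L)
    (k : ℕ) (h : k + 1 ≤ d) (R : Finset (Bits n)) :
    𝔼 ω : Sample n d, (if R ⊆ (simRun C ω f θ (k + 1) h).2 \
      (simRun C ω f θ k (Nat.le_of_succ_le h)).2 then (1 : ℝ) else 0) ≤
      (2 * d * L / 2 ^ ((d + 2) * n)) ^ #R := by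
  rw [expect_univ_prod]
  refine expect_le univ_nonempty fun β _ => ?_
  rw [expect_mix k R]
  refine expect_le univ_nonempty fun a _ => ?_
  set E : (Bits n → Fin d → Dom n d) → Prop := fun c =>
    R ⊆ (simRun C (β, mix k R a c) f θ (k + 1) h).2 \
      (simRun C (β, mix k R a c) f θ k (Nat.le_of_succ_le h)).2 with hE
  -- The state `φ` is taken from one successful choice `c₀`. All successful choices lead to the same
  -- state, so the heavy points do not depend on `c`, and the conditions on `c x` for different `x`
  -- are independent.
  by_cases hex : ∃ c, E c
  · obtain ⟨c₀, hc₀⟩ := hex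
    set φ := simQuery C (β, mix k R a c₀) f θ k h with hφ
    set G : (Fin d → Dom n d) → Prop := fun v => ∃ i : Fin d, θ < levelMass φ i.succ (v i) ∨
      θ < levelMass φ i.castSucc ((β i).symm (v i)) with hG
    have hEG : ∀ c, E c → ∀ x ∈ R, G (c x) := by
      intro c hc x hx
      have hd : ∀ c, E c →
          Disjoint R (simRun C (β, mix k R a c) f θ k (Nat.le_of_succ_le h)).2 := by
        intro c hc
        rw [Finset.disjoint_left]
        exact fun y hy => (mem_sdiff.1 (hc hy)).2
      have hrun := simRun_congr_sample C f θ (ω := (β, mix k R a c)) (ω' := (β, mix k R a c₀)) rfl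
        (R := R) (K := k) (by
          intro x i hxi
          have : ¬ (x ∈ R ∧ k ≤ (i : ℕ)) := by
            rintro ⟨h₁, h₂⟩
            rcases hxi with hxi | hxi
            · exact hxi h₁
            · omega
          simp only [mix, if_neg this]) k (Nat.le_of_succ_le h) le_rfl (hd c hc) (hd c₀ hc₀)
      have hq : simQuery C (β, mix k R a c) f θ k h = φ := by
        rw [hφ]; unfold simQuery; rw [hrun]
      have hx' := mem_sdiff.1 (hc hx)
      rw [simRun_succ_snd, mem_union, hq] at hx'
      have hhit := (mem_filter.1 (hx'.1.resolve_left hx'.2)).2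
      exact hit_mix hx hhit
    have hφ1 : l2 φ = 1 := l2_simQuery _ _ _ _ _ _
    calc 𝔼 c, (if E c then (1 : ℝ) else 0)
        ≤ 𝔼 c : Bits n → Fin d → Dom n d,
            ∏ x, (if x ∈ R then fun v => if G v then (1 : ℝ) else 0 else fun _ => 1) (c x) := by
          refine expect_le_expect fun c _ => ?_
          split_ifs with hc
          · rw [prod_eq_one]
            intro x _
            split_ifs with hx
            · exact if_pos (hEG c hc x hx)
            · rfl
          · refine prod_nonneg fun x _ => ?_
            split_ifs
            · dsimp only; split_ifs <;> norm_num
            · norm_num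
      _ = ∏ x, 𝔼 v, (if x ∈ R then fun v => if G v then (1 : ℝ) else 0 else fun _ => 1) v :=
          expect_prod_apply _
      _ = ∏ x, if x ∈ R then 𝔼 v, (if G v then (1 : ℝ) else 0) else 1 := by
          refine prod_congr rfl fun x _ => ?_
          split_ifs
          · rfl
          · exact Fintype.expect_const _
      _ = (𝔼 v, (if G v then (1 : ℝ) else 0)) ^ #R := by
          rw [prod_ite]
          simp
      _ ≤ _ := by
          refine pow_le_pow_left₀ (expect_nonneg fun v _ => by split_ifs <;> norm_num) ?_ _
          exact expect_heavy_le β (hL φ hφ1)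
  · push Not at hex
    have hL0 : 0 ≤ L := (Nat.cast_nonneg _).trans (hL (Pi.single 0 1) l2_single 0)
    rw [expect_eq_zero fun c _ => if_neg (hex c)]
    positivity

-- Union bound over the `r`-element sets of new paths, of which there are at most `(2 ^ n) ^ r`.
open scoped Classical in
theorem expect_found_step_le (C : Circuit n d q w) (f : Bits n → Bits n) {θ L : ℝ}
    (hL : ∀ φ : State n d q w, l2 φ = 1 → ∀ j, (#{y | θ < levelMass φ j y} : ℝ) ≤ L)
    (k : ℕ) (h : k + 1 ≤ d) (r : ℕ) :
    𝔼 ω : Sample n d, (if r ≤ #((simRun C ω f θ (k + 1) h).2 \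
      (simRun C ω f θ k (Nat.le_of_succ_le h)).2) then (1 : ℝ) else 0) ≤
      (2 ^ n * (2 * d * L / 2 ^ ((d + 2) * n))) ^ r := by
  have hL0 : 0 ≤ L := (Nat.cast_nonneg _).trans (hL (Pi.single 0 1) l2_single 0)
  set D : Sample n d → Finset (Bits n) := fun ω => (simRun C ω f θ (k + 1) h).2 \
      (simRun C ω f θ k (Nat.le_of_succ_le h)).2
  calc 𝔼 ω : Sample n d, (if r ≤ #(D ω) then (1 : ℝ) else 0)
      ≤ 𝔼 ω : Sample n d, ∑ R ∈ powersetCard r univ, (if R ⊆ D ω then (1 : ℝ) else 0) := by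
        refine expect_le_expect fun ω _ => ?_
        split_ifs with hr
        · obtain ⟨R, hRD, hRr⟩ := exists_subset_card_eq hr
          have := single_le_sum (f := fun R => if R ⊆ D ω then (1 : ℝ) else 0)
            (fun R _ => by split_ifs <;> norm_num)
            (mem_powersetCard.2 ⟨subset_univ R, hRr⟩)
          simpa [hRD] using this
        · exact sum_nonneg fun R _ => by split_ifs <;> norm_num
    _ = ∑ R ∈ powersetCard r univ, 𝔼 ω : Sample n d, (if R ⊆ D ω then (1 : ℝ) else 0) :=
        expect_sum_comm _ _ _
    _ ≤ ∑ R ∈ powersetCard r (univ : Finset (Bits n)), (2 * d * L / 2 ^ ((d + 2) * n)) ^ r := by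
        refine sum_le_sum fun R hR => ?_
        rw [← (mem_powersetCard.1 hR).2]
        exact expect_subset_found_le C f hL k h R
    _ ≤ _ := by
        rw [sum_const, card_powersetCard, nsmul_eq_mul, mul_pow]
        refine mul_le_mul_of_nonneg_right ?_ (by positivity)
        have : (Fintype.card (Bits n)).choose r ≤ (Fintype.card (Bits n)) ^ r := Nat.choose_le_pow _ _
        rw [Finset.card_univ]
        calc (((Fintype.card (Bits n)).choose r : ℕ) : ℝ) ≤ ((Fintype.card (Bits n) ^ r : ℕ) : ℝ) := by
              exact_mod_cast this
          _ = _ := by simp [ZMod.card]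

open scoped Classical in
theorem expect_found_le (C : Circuit n d q w) (f : Bits n → Bits n) {θ L : ℝ}
    (hL : ∀ φ : State n d q w, l2 φ = 1 → ∀ j, (#{y | θ < levelMass φ j y} : ℝ) ≤ L) (r : ℕ) :
    𝔼 ω : Sample n d, (if d * r < #(simFound C ω f θ) then (1 : ℝ) else 0) ≤
      d * (2 ^ n * (2 * d * L / 2 ^ ((d + 2) * n))) ^ r := by
  have hcard : ∀ (ω : Sample n d) (k : ℕ) (h : k ≤ d), (∀ i (hi : i + 1 ≤ d), ¬ r ≤
      #((simRun C ω f θ (i + 1) hi).2 \ (simRun C ω f θ i (Nat.le_of_succ_le hi)).2)) →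
      #(simRun C ω f θ k h).2 ≤ k * r := by
    intro ω k h hcon
    induction k with
    | zero => simp [simRun]
    | succ k ih =>
      have h₁ := hcon k h
      have h₂ := ih (Nat.le_of_succ_le h)
      have h₃ := card_sdiff_add_card_eq_card (simRun_mono C ω f θ k h)
      rw [Nat.succ_mul]
      omega
  calc _ ≤ 𝔼 ω : Sample n d, ∑ k : Fin d, (if r ≤ #((simRun C ω f θ (k + 1) k.2).2 \
      (simRun C ω f θ k k.2.le).2) then (1 : ℝ) else 0) := by
        refine expect_le_expect fun ω _ => ?_
        split_ifs with hr
        · obtain ⟨k, hk, hkr⟩ : ∃ k, ∃ hk : k + 1 ≤ d, r ≤ #((simRun C ω f θ (k + 1) hk).2 \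
              (simRun C ω f θ k (Nat.le_of_succ_le hk)).2) := by
            by_contra! hcon
            have := hcard ω d le_rfl fun i hi => not_le.2 (hcon i hi)
            exact absurd hr (not_lt.2 this)
          have := single_le_sum (f := fun k : Fin d => if r ≤ #((simRun C ω f θ (k + 1) k.2).2 \
            (simRun C ω f θ k k.2.le).2) then (1 : ℝ) else 0)
            (fun R _ => by split_ifs <;> norm_num) (mem_univ ⟨k, hk⟩)
          simpa [hkr] using this
        · exact sum_nonneg fun R _ => by split_ifs <;> norm_num
    _ = ∑ k : Fin d, 𝔼 ω : Sample n d, (if r ≤ #((simRun C ω f θ (k + 1) k.2).2 \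
      (simRun C ω f θ k k.2.le).2) then (1 : ℝ) else 0) := expect_sum_comm _ _ _
    _ ≤ ∑ _k : Fin d, (2 ^ n * (2 * d * L / 2 ^ ((d + 2) * n))) ^ r :=
        sum_le_sum fun k _ => expect_found_step_le C f hL k k.2 r
    _ = _ := by simp

/-- The threshold for the query mass of a point. -/
def threshold (n d q : ℕ) : ℝ := 8 * d * q * 2 ^ n / 2 ^ ((d + 2) * n)

theorem threshold_nonneg : 0 ≤ threshold n d q := by
  unfold threshold; positivity

-- The threshold `θ` is chosen such that at most `q / θ` heavy points per level give the base `2 ^ n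
-- * 2 * d * (q / θ) / 2 ^ ((d + 2) * n) = 1 / 4`. The factor `q` makes the bound vanish when there
-- are no query registers.
open scoped Classical in
theorem expect_found_threshold_le (C : Circuit n d q w) (f : Bits n → Bits n) (r : ℕ) :
    𝔼 ω : Sample n d,
      (if d * r < #(simFound C ω f (threshold n d q)) then (1 : ℝ) else 0) ≤
      d * q * (1 / 4) ^ r := by
  rcases Nat.eq_zero_or_pos d with rfl | hd
  · simp [simFound, simRun]
  rcases Nat.eq_zero_or_pos q with rfl | hq
  · have hmass : ∀ (φ : State n d 0 w) j y, levelMass φ j y = 0 := by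
      intro φ j y; simp [levelMass]
    have : ∀ (ω : Sample n d) k (h : k ≤ d), (simRun C ω f (threshold n d 0) k h).2 = ∅ := by
      intro ω k h
      induction k with
      | zero => rfl
      | succ k ih =>
        rw [simRun_succ_snd, ih, empty_union]
        simp [Hit, hmass, threshold]
    simp [simFound, this]
  · have hθ : 0 < threshold n d q := by unfold threshold; positivity
    have hL : ∀ φ : State n d q w, l2 φ = 1 → ∀ j,
        (#{y | threshold n d q < levelMass φ j y} : ℝ) ≤ q / threshold n d q := by
      intro φ hφ j
      rw [le_div_iff₀ hθ]
      have := card_heavy_mul_le φ j (threshold n d q)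
      rwa [hφ, one_pow, mul_one] at this
    refine (expect_found_le C f hL r).trans ?_
    have h₁ : (2 : ℝ) ^ n * (2 * d * (q / threshold n d q) / 2 ^ ((d + 2) * n)) = 1 / 4 := by
      unfold threshold
      have : (d : ℝ) ≠ 0 := by positivity
      have : (q : ℝ) ≠ 0 := by positivity
      field_simp
      norm_num
    rw [h₁]
    refine mul_le_mul_of_nonneg_right ?_ (by positivity)
    exact le_mul_of_one_le_right (by positivity) (by exact_mod_cast hq)

/-! ### Functions that depend on few values of `f` -/

open scoped Classical in
/-- Nonnegative combinations of indicator functions of conditions on at most `Q` values of `f`. -/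
inductive IsLocal (Q : ℕ) : ((Bits n → Bits n) → ℝ) → Prop
  | zero : IsLocal Q fun _ => 0
  | add {g h : (Bits n → Bits n) → ℝ} (hg : IsLocal Q g) (hh : IsLocal Q h) :
      IsLocal Q fun f => g f + h f
  | indicator (X : Finset (Bits n)) (v : Bits n → Bits n) {c : ℝ} (hc : 0 ≤ c) (hX : #X ≤ Q) :
      IsLocal Q fun f => if ∀ x ∈ X, f x = v x then c else 0

namespace IsLocal

variable {Q Q' : ℕ} {g h : (Bits n → Bits n) → ℝ}

theorem mono (hg : IsLocal Q g) (hQ : Q ≤ Q') : IsLocal Q' g := by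
  induction hg with
  | zero => exact zero
  | add _ _ ih₁ ih₂ => exact add ih₁ ih₂
  | indicator X v hc hX => exact indicator X v hc (hX.trans hQ)

theorem const {c : ℝ} (hc : 0 ≤ c) : IsLocal (n := n) Q fun _ => c := by
  simpa using indicator (n := n) (Q := Q) ∅ id hc (by simp)

theorem sum {ι : Type*} (s : Finset ι) {g : ι → (Bits n → Bits n) → ℝ}
    (hg : ∀ i ∈ s, IsLocal Q (g i)) : IsLocal Q fun f => ∑ i ∈ s, g i f := by
  classical
  induction s using Finset.induction_on with
  | empty => simpa using zero
  | insert a s ha ih =>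
    simp only [sum_insert ha]
    exact add (hg a (mem_insert_self a s)) (ih fun i hi => hg i (mem_insert_of_mem hi))

/-- A product of two indicators is an indicator on the union if the prescribed values are
compatible, and zero otherwise. -/
theorem mul (hg : IsLocal Q g) (hh : IsLocal Q' h) : IsLocal (Q + Q') fun f => g f * h f := by
  classical
  induction hg with
  | zero => simpa using zero
  | add _ _ ih₁ ih₂ => simpa [add_mul] using add ih₁ ih₂
  | indicator X v hc hX =>
    rename_i c
    induction hh with
    | zero => simpa using zero
    | add _ _ ih₁ ih₂ => simpa only [mul_add] using add ih₁ ih₂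
    | indicator Y u hc' hY =>
      rename_i c'
      by_cases hXY : ∀ x ∈ X, x ∈ Y → v x = u x
      · have := indicator (Q := Q + Q') (X ∪ Y) (fun x => if x ∈ X then v x else u x)
          (mul_nonneg hc hc') ((card_union_le X Y).trans (add_le_add hX hY))
        convert this using 2 with f
        have hiff : (∀ x ∈ X ∪ Y, f x = if x ∈ X then v x else u x) ↔
            (∀ x ∈ X, f x = v x) ∧ ∀ x ∈ Y, f x = u x := by
          constructor
          · intro H
            have h₁ : ∀ x ∈ X, f x = v x := fun x hx => by
              simpa [hx] using H x (mem_union_left _ hx)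
            refine ⟨h₁, fun x hx => ?_⟩
            have := H x (mem_union_right _ hx)
            by_cases hxX : x ∈ X
            · rw [h₁ x hxX, hXY x hxX hx]
            · simpa [hxX] using this
          · rintro ⟨h₁, h₂⟩ x hx
            by_cases hxX : x ∈ X
            · simpa [hxX] using h₁ x hxX
            · simpa [hxX] using h₂ x ((mem_union.1 hx).resolve_left hxX)
        dsimp only
        by_cases h₁ : ∀ x ∈ X, f x = v x <;> by_cases h₂ : ∀ x ∈ Y, f x = u x
        · rw [if_pos h₁, if_pos h₂, if_pos (hiff.2 ⟨h₁, h₂⟩)]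
        · rw [if_neg h₂, if_neg fun H => h₂ (hiff.1 H).2, mul_zero]
        · rw [if_neg h₁, if_neg fun H => h₁ (hiff.1 H).1, zero_mul]
        · rw [if_neg h₁, if_neg fun H => h₁ (hiff.1 H).1, zero_mul]
      · push Not at hXY
        obtain ⟨x, hxX, hxY, hne⟩ := hXY
        have : (fun f : Bits n → Bits n => (if ∀ x ∈ X, f x = v x then c else 0) *
            if ∀ x ∈ Y, f x = u x then c' else 0) = fun _ => 0 := by
          funext f
          by_cases h₁ : ∀ x ∈ X, f x = v x
          · by_cases h₂ : ∀ x ∈ Y, f x = u x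
            · exact absurd ((h₁ x hxX).symm.trans (h₂ x hxY)) hne
            · rw [if_neg h₂, mul_zero]
          · rw [if_neg h₁, zero_mul]
        rw [this]
        exact zero

theorem const_mul {c : ℝ} (hc : 0 ≤ c) (hg : IsLocal Q g) : IsLocal Q fun f => c * g f := by
  simpa using (const (Q := 0) hc).mul hg

/-- A function is local if its value at `f` is determined by the values of `f` on a small set
`T f` which is itself determined by these values. -/
theorem of_certificate (T : (Bits n → Bits n) → Finset (Bits n)) (hg : ∀ f, 0 ≤ g f)
    (hT : ∀ f f', (∀ x ∈ T f, f' x = f x) → T f' = T f ∧ g f' = g f)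
    (hQ : ∀ f, g f ≠ 0 → #(T f) ≤ Q) : IsLocal Q g := by
  classical
  set cls : (Bits n → Bits n) → Finset (Bits n → Bits n) := fun f₀ =>
    univ.filter fun f => ∀ x ∈ T f₀, f x = f₀ x with hcls
  have hself : ∀ f, f ∈ cls f := fun f => by simp [hcls]
  have hmem : ∀ f f₀, f ∈ cls f₀ → cls f₀ = cls f := by
    intro f f₀ hf
    have hf' : ∀ x ∈ T f₀, f x = f₀ x := by simpa [hcls] using hf
    ext f'
    simp only [hcls, mem_filter, mem_univ, true_and, (hT f₀ f hf').1]
    exact forall₂_congr fun x hx => by rw [hf' x hx]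
  -- The classes `cls f₀` partition the functions and `g` is constant on each. The sum runs over
  -- functions instead of classes, hence the division by the class size.
  have key : g = fun f => ∑ f₀, if ∀ x ∈ T f₀, f x = f₀ x then g f₀ / #(cls f₀) else 0 := by
    funext f
    have h₁ : ∀ f₀, (if ∀ x ∈ T f₀, f x = f₀ x then g f₀ / #(cls f₀) else 0) =
        if f₀ ∈ cls f then g f / #(cls f) else 0 := by
      intro f₀
      by_cases hf : ∀ x ∈ T f₀, f x = f₀ x
      · have hf' : f ∈ cls f₀ := by simpa [hcls] using hf
        have e := hmem f f₀ hf'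
        rw [if_pos hf, if_pos (e ▸ hself f₀), (hT f₀ f hf).2, e]
      · rw [if_neg hf, if_neg]
        intro hf'
        have e := hmem f₀ f hf'
        have : f ∈ cls f₀ := e ▸ hself f
        exact hf (by simpa [hcls] using this)
    simp only [h₁]
    rw [← sum_filter]
    simp only [filter_mem_eq_inter, univ_inter, sum_const, nsmul_eq_mul]
    have : (#(cls f) : ℝ) ≠ 0 := by
      exact_mod_cast (card_pos.2 ⟨f, hself f⟩).ne'
    field_simp
  rw [key]
  refine sum _ fun f₀ _ => ?_
  by_cases h₀ : g f₀ = 0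
  · simpa [h₀] using zero
  · exact indicator (T f₀) f₀ (div_nonneg (hg f₀) (Nat.cast_nonneg _)) (hQ f₀ h₀)

end IsLocal

/-! ### Simon functions look injective on few points -/

theorem IsSimon.comp_perm {f : Bits n → Bits n} (hf : IsSimon f) (g : Perm (Bits n)) :
    IsSimon fun x => g (f x) := by
  obtain ⟨s, hs, h⟩ := hf
  exact ⟨s, hs, fun x y => by rw [g.injective.eq_iff, h]⟩

theorem IsSimon.comp_addEquiv {f : Bits n → Bits n} (hf : IsSimon f) (A : Bits n ≃+ Bits n) :
    IsSimon fun x => f (A x) := by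
  obtain ⟨s, hs, h⟩ := hf
  refine ⟨A.symm s, by simpa using hs, fun x y => ?_⟩
  rw [h, A.injective.eq_iff]
  refine or_congr Iff.rfl ?_
  rw [← A.injective.eq_iff (a := y), map_add, A.apply_symm_apply]

theorem mem_simonFunctions {f : Bits n → Bits n} : f ∈ simonFunctions n ↔ IsSimon f := by
  simp [simonFunctions]

theorem bits_add_self (x : Bits n) : x + x = 0 := by
  funext i
  exact CharTwo.add_self_eq_zero (x i)

theorem bits_eq_add_iff {x y s : Bits n} : y = x + s ↔ x + y = s := by
  constructor
  · rintro rfl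
    rw [← add_assoc, bits_add_self, zero_add]
  · rintro rfl
    rw [← add_assoc, bits_add_self, zero_add]

theorem simonFunctions_nonempty (hn : 0 < n) : (simonFunctions n).Nonempty := by
  set e : Bits n := Pi.single ⟨0, hn⟩ 1 with he
  refine ⟨fun x => Function.update x ⟨0, hn⟩ 0, mem_simonFunctions.2 ⟨e, ?_, fun x y => ?_⟩⟩
  · simp [he]
  · constructor
    · intro h
      have h' : ∀ i, i ≠ ⟨0, hn⟩ → x i = y i := fun i hi => by
        simpa [hi] using congrFun h i
      have hz : ∀ a b : ZMod 2, b = a ∨ b = a + 1 := by decide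
      rcases hz (x ⟨0, hn⟩) (y ⟨0, hn⟩) with h₀ | h₀
      · left
        funext i
        by_cases hi : i = ⟨0, hn⟩
        · rw [hi, h₀]
        · exact (h' i hi).symm
      · right
        funext i
        by_cases hi : i = ⟨0, hn⟩
        · rw [hi, h₀]; simp [he]
        · simp [he, hi, h' i hi]
    · rintro (rfl | rfl)
      · rfl
      · funext i
        by_cases hi : i = ⟨0, hn⟩
        · subst hi; simp
        · simp [hi, he]

/-- If a functional `φ` is `1` on both vectors, then `φ (u + v) = 0`, so `x ↦ x + φ x • (u + v)` is
an involution, and it sends `u` to `v`. Such a `φ` is a coordinate or a sum of two coordinates. -/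
theorem exists_addEquiv_apply_eq {u v : Bits n} (hu : u ≠ 0) (hv : v ≠ 0) :
    ∃ A : Bits n ≃+ Bits n, A u = v := by
  have hone : ∀ a : ZMod 2, a ≠ 0 → a = 1 := by decide
  obtain ⟨φ, hφu, hφv⟩ : ∃ φ : Bits n →+ ZMod 2, φ u = 1 ∧ φ v = 1 := by
    obtain ⟨i, hi⟩ := Function.ne_iff.1 hu
    obtain ⟨k, hk⟩ := Function.ne_iff.1 hv
    replace hi := hone _ hi
    replace hk := hone _ hk
    by_cases hvi : v i = 0
    · by_cases huk : u k = 0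
      · refine ⟨Pi.evalAddMonoidHom (fun _ : Fin n => ZMod 2) i +
          Pi.evalAddMonoidHom (fun _ : Fin n => ZMod 2) k, ?_, ?_⟩
        · simp [hi, huk]
        · simp [hk, hvi]
      · exact ⟨Pi.evalAddMonoidHom (fun _ : Fin n => ZMod 2) k, hone _ huk, hk⟩
    · exact ⟨Pi.evalAddMonoidHom (fun _ : Fin n => ZMod 2) i, hi, hone _ hvi⟩
  have h₀ : φ (u + v) = 0 := by rw [map_add, hφu, hφv]; decide
  have hadd : ∀ a b : ZMod 2, (a + b) • (u + v) = a • (u + v) + b • (u + v) := fun a b =>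
    add_smul a b _
  have hφsmul : ∀ a : ZMod 2, φ (a • (u + v)) = 0 := by
    intro a
    have : a = 0 ∨ a = 1 := by revert a; decide
    rcases this with rfl | rfl
    · simp
    · simpa using h₀
  have hinv : ∀ x, (x + φ x • (u + v)) + φ (x + φ x • (u + v)) • (u + v) = x := by
    intro x
    rw [map_add, hφsmul, add_zero, add_assoc, bits_add_self, add_zero]
  refine ⟨⟨⟨fun x => x + φ x • (u + v), fun x => x + φ x • (u + v), hinv, hinv⟩, ?_⟩, ?_⟩
  · intro x y
    simp only [map_add, hadd]
    abel
  · change u + φ u • (u + v) = v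
    rw [hφu, one_smul, ← add_assoc, bits_add_self, zero_add]

theorem IsSimon.apply_eq_iff {f : Bits n → Bits n} (hf : IsSimon f) {x y : Bits n} :
    f x = f y ↔ f 0 = f (x + y) := by
  obtain ⟨s, hs, h⟩ := hf
  rw [h, h, bits_eq_add_iff, bits_eq_add_iff, zero_add]
  refine or_congr ?_ Iff.rfl
  constructor
  · rintro rfl; exact bits_add_self y
  · intro e
    have := bits_eq_add_iff.2 e
    rwa [add_zero] at this

/-- The probability of `f 0 = f u` is the same for all `u ≠ 0`, by linear symmetry. Each Simon
function has two such `u` including `0`, so it equals `1 / (2 ^ n - 1)`. -/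
theorem expect_simon_collision_le (hn : 0 < n) {x y : Bits n} (hxy : x ≠ y) :
    𝔼 f ∈ simonFunctions n, (if f x = f y then (1 : ℝ) else 0) ≤ 2 / 2 ^ n := by
  set c : Bits n → ℝ := fun u => 𝔼 f ∈ simonFunctions n, (if f 0 = f u then (1 : ℝ) else 0) with hc
  have hne : x + y ≠ 0 := by
    intro e
    have := bits_eq_add_iff.2 e
    rw [add_zero] at this
    exact hxy this.symm
  have h₁ : 𝔼 f ∈ simonFunctions n, (if f x = f y then (1 : ℝ) else 0) = c (x + y) := by
    refine expect_congr rfl fun f hf => ?_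
    exact if_congr (mem_simonFunctions.1 hf).apply_eq_iff rfl rfl
  have h₂ : ∀ u, u ≠ 0 → c u = c (x + y) := by
    intro u hu
    obtain ⟨A, hA⟩ := exists_addEquiv_apply_eq hu hne
    let e : Perm (Bits n → Bits n) := Equiv.arrowCongr A.toEquiv.symm (Equiv.refl _)
    have he : ∀ f x, e f x = f (A x) := fun f x => rfl
    refine (expect_equiv e (fun f => ?_) fun f _ => ?_).symm
    · rw [mem_simonFunctions, mem_simonFunctions]
      refine ⟨fun h => h.comp_addEquiv A, fun h => ?_⟩
      have := h.comp_addEquiv A.symm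
      simpa [he] using this
    · simp only [he, map_zero, hA]
  have h₃ : ∑ u, c u = 2 := by
    simp only [hc]
    rw [← expect_sum_comm]
    rw [expect_congr rfl fun f hf => show _ = (2 : ℝ) from ?_]
    · exact expect_const (simonFunctions_nonempty hn) _
    · obtain ⟨s, hs, h⟩ := mem_simonFunctions.1 hf
      simp only [h, zero_add]
      rw [sum_boole]
      have : (univ.filter fun u : Bits n => u = 0 ∨ u = s) = {0, s} := by
        ext u; simp
      rw [this, card_pair hs.symm]
      norm_num
  have h₄ : c 0 = 1 := by
    simp only [hc, if_true]
    exact expect_const (simonFunctions_nonempty hn) _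
  have h₅ : c (x + y) ≤ 1 := by
    refine expect_le (simonFunctions_nonempty hn) fun f _ => ?_
    split_ifs <;> norm_num
  have h₆ : ∑ u, c u = 1 + (2 ^ n - 1) * c (x + y) := by
    rw [← add_sum_erase univ c (mem_univ 0), h₄,
      sum_congr rfl fun u hu => h₂ u (ne_of_mem_erase hu), sum_const, card_erase_of_mem (mem_univ _),
      nsmul_eq_mul, card_univ]
    rw [Nat.cast_sub Fintype.card_pos]
    simp [ZMod.card]
  rw [h₁, le_div_iff₀ (by positivity)]
  nlinarith

open scoped Classical in
theorem expect_simon_not_injOn_le (hn : 0 < n) (X : Finset (Bits n)) :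
    𝔼 f ∈ simonFunctions n, (if Set.InjOn f (X : Set (Bits n)) then (0 : ℝ) else 1) ≤
      2 * #X ^ 2 / 2 ^ n := by
  calc _ ≤ 𝔼 f ∈ simonFunctions n, ∑ x ∈ X, ∑ y ∈ X,
        (if x ≠ y ∧ f x = f y then (1 : ℝ) else 0) := by
        refine expect_le_expect fun f _ => ?_
        have nn : ∀ x y, (0 : ℝ) ≤ if x ≠ y ∧ f x = f y then (1 : ℝ) else 0 := fun x y => by
          split_ifs <;> norm_num
        split_ifs with h
        · exact sum_nonneg fun x _ => sum_nonneg fun y _ => nn x y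
        · obtain ⟨x, hx, y, hy, hf, hxy⟩ : ∃ x ∈ X, ∃ y ∈ X, f x = f y ∧ x ≠ y := by
            by_contra! hcon
            exact h fun x hx y hy e => hcon x hx y hy e
          calc (1 : ℝ) = if x ≠ y ∧ f x = f y then (1 : ℝ) else 0 := by rw [if_pos ⟨hxy, hf⟩]
            _ ≤ ∑ y ∈ X, (if x ≠ y ∧ f x = f y then (1 : ℝ) else 0) :=
                single_le_sum (f := fun y => if x ≠ y ∧ f x = f y then (1 : ℝ) else 0)
                  (fun y _ => nn x y) hy
            _ ≤ _ := single_le_sum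
                  (f := fun x => ∑ y ∈ X, if x ≠ y ∧ f x = f y then (1 : ℝ) else 0)
                  (fun x _ => sum_nonneg fun y _ => nn x y) hx
    _ = ∑ x ∈ X, ∑ y ∈ X, 𝔼 f ∈ simonFunctions n,
          (if x ≠ y ∧ f x = f y then (1 : ℝ) else 0) := by
        rw [expect_sum_comm]
        exact sum_congr rfl fun x _ => expect_sum_comm _ _ _
    _ ≤ ∑ x ∈ X, ∑ y ∈ X, 2 / 2 ^ n := by
        refine sum_le_sum fun x _ => sum_le_sum fun y _ => ?_
        by_cases hxy : x = y
        · simp only [hxy, ne_eq, not_true_eq_false, false_and, if_false, expect_const_zero]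
          positivity
        · simp only [ne_eq, hxy, not_false_eq_true, true_and]
          exact expect_simon_collision_le hn hxy
    _ = _ := by
        simp only [sum_const, nsmul_eq_mul]
        ring

open scoped Classical in
theorem expect_injective_eq_expect_perm (φ : (Bits n → Bits n) → ℝ) :
    𝔼 f ∈ injectiveFunctions n, φ f = 𝔼 g : Perm (Bits n), φ g := by
  symm
  refine expect_nbij (fun g : Perm (Bits n) => (g : Bits n → Bits n)) ?_ (fun _ _ => rfl) ?_ ?_
  · intro g _
    simpa [injectiveFunctions] using g.injective
  · exact fun g _ g' _ h => DFunLike.coe_injective h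
  · intro f hf
    have hf' : Function.Injective f := by simpa [injectiveFunctions] using hf
    exact ⟨Equiv.ofBijective f (Finite.injective_iff_bijective.1 hf'), by simp, rfl⟩

theorem expect_simon_eq_expect_comp_perm (φ : (Bits n → Bits n) → ℝ) :
    𝔼 f ∈ simonFunctions n, φ f =
      𝔼 f ∈ simonFunctions n, 𝔼 g : Perm (Bits n), φ fun x => g (f x) := by
  rw [expect_comm]
  have h : ∀ g : Perm (Bits n), 𝔼 f ∈ simonFunctions n, φ (fun x => g (f x)) =
      𝔼 f ∈ simonFunctions n, φ f := by
    intro g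
    let e : Perm (Bits n → Bits n) := Equiv.arrowCongr (Equiv.refl _) g
    refine expect_equiv e (fun f => ?_) fun f _ => rfl
    rw [mem_simonFunctions, mem_simonFunctions]
    refine ⟨fun h => h.comp_perm g, fun h => ?_⟩
    have := h.comp_perm g.symm
    simpa [e] using this
  simp only [h]
  exact (Fintype.expect_const _).symm

/-- An injection on `X` extends to a permutation, and right multiplication by it permutes the group.
-/
theorem expect_perm_comp (X : Finset (Bits n)) {f : Bits n → Bits n}
    (hf : Set.InjOn f (X : Set (Bits n))) (v : Bits n → Bits n) (c : ℝ) :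
    𝔼 g : Perm (Bits n), (if ∀ x ∈ X, g (f x) = v x then c else 0) =
      𝔼 g : Perm (Bits n), (if ∀ x ∈ X, g x = v x then c else 0) := by
  obtain ⟨e, he⟩ := Finset.exists_equiv_extend_of_card_eq (t := (univ : Finset (Bits n)))
    (by simp) (s := X) (f := f) (subset_univ _) hf
  let e' : Perm (Bits n) := e.trans (Equiv.subtypeUnivEquiv fun x => mem_univ x)
  have he' : ∀ x ∈ X, e' x = f x := he
  refine Fintype.expect_equiv (Equiv.mulRight e') _ _ fun g => ?_
  have : (∀ x ∈ X, g (f x) = v x) ↔ ∀ x ∈ X, (Equiv.mulRight e' g) x = v x := by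
    refine forall₂_congr fun x hx => ?_
    rw [Equiv.coe_mulRight, Perm.mul_apply, he' x hx]
  simp only [this]

/-- After composition with a random permutation, a Simon function that is injective on `X` looks on
`X` like a random permutation. The other Simon functions are discarded, which is harmless because
the coefficients are nonnegative. -/
theorem IsLocal.expect_injective_le {Q : ℕ} {g : (Bits n → Bits n) → ℝ} (hn : 0 < n)
    (hg : IsLocal Q g) : (1 - 2 * Q ^ 2 / 2 ^ n) * 𝔼 f ∈ injectiveFunctions n, g f ≤
      𝔼 f ∈ simonFunctions n, g f := by
  classical
  induction hg with
  | zero => simp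
  | add _ _ ih₁ ih₂ =>
    rw [expect_add_distrib, expect_add_distrib, mul_add]
    exact add_le_add ih₁ ih₂
  | indicator X v hc hX =>
    rename_i c
    set P : ℝ := 𝔼 g : Perm (Bits n), (if ∀ x ∈ X, g x = v x then c else 0) with hP
    have hP0 : 0 ≤ P := expect_nonneg fun g _ => by split_ifs; exacts [hc, le_rfl]
    have h₁ : 𝔼 f ∈ injectiveFunctions n, (if ∀ x ∈ X, f x = v x then c else 0) = P :=
      expect_injective_eq_expect_perm _
    have h₂ : 𝔼 f ∈ simonFunctions n, P *
        (1 - if Set.InjOn f (X : Set (Bits n)) then (0 : ℝ) else 1) ≤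
        𝔼 f ∈ simonFunctions n, (if ∀ x ∈ X, f x = v x then c else 0) := by
      rw [expect_simon_eq_expect_comp_perm fun f => if ∀ x ∈ X, f x = v x then c else 0]
      refine expect_le_expect fun f _ => ?_
      split_ifs with hf
      · rw [expect_perm_comp X hf, sub_zero, mul_one]
      · rw [sub_self, mul_zero]
        exact expect_nonneg fun g _ => by split_ifs; exacts [hc, le_rfl]
    have h₃ := expect_simon_not_injOn_le hn X
    rw [h₁]
    refine le_trans ?_ h₂
    rw [← mul_expect, expect_sub_distrib, expect_const (simonFunctions_nonempty hn), mul_comm]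
    refine mul_le_mul_of_nonneg_left ?_ hP0
    have h₄ : (2 * #X ^ 2 / 2 ^ n : ℝ) ≤ 2 * Q ^ 2 / 2 ^ n := by
      have : (#X : ℝ) ≤ Q := by exact_mod_cast hX
      gcongr
    linarith

/-! ### Simulating a scheme with few values of `f` -/

namespace CQScheme

theorem acceptProb_mem (F : Fin (d + 1) → Dom n d → Answer n d) (A : CQScheme n d q w) :
    0 ≤ A.acceptProb F ∧ A.acceptProb F ≤ 1 := by
  induction A with
  | output b => cases b <;> simp [acceptProb]
  | coin next ih =>
    have h₀ := ih false
    have h₁ := ih true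
    simp only [acceptProb]
    constructor <;> linarith [h₀.1, h₀.2, h₁.1, h₁.2]
  | query j x next ih => exact ih _
  | run C next ih =>
    simp only [acceptProb]
    refine ⟨sum_nonneg fun z _ => mul_nonneg (outcomeProb_nonneg C F z) (ih z).1, ?_⟩
    rw [← sum_outcomeProb C F]
    exact sum_le_sum fun z _ => mul_le_of_le_one_right (outcomeProb_nonneg C F z) (ih z).2

/-- The probability that the scheme outputs `0`. -/
def rejectProb (F : Fin (d + 1) → Dom n d → Answer n d) (A : CQScheme n d q w) : ℝ :=
  1 - A.acceptProb F

theorem rejectProb_nonneg (F : Fin (d + 1) → Dom n d → Answer n d) (A : CQScheme n d q w) :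
    0 ≤ A.rejectProb F := sub_nonneg.2 (acceptProb_mem F A).2

theorem rejectProb_le_one (F : Fin (d + 1) → Dom n d → Answer n d) (A : CQScheme n d q w) :
    A.rejectProb F ≤ 1 := sub_le_self _ (acceptProb_mem F A).1

theorem rejectProb_coin (F : Fin (d + 1) → Dom n d → Answer n d)
    (next : Bool → CQScheme n d q w) : (coin next).rejectProb F =
      ((next false).rejectProb F + (next true).rejectProb F) / 2 := by
  simp only [rejectProb, acceptProb]
  ring

theorem rejectProb_run (F : Fin (d + 1) → Dom n d → Answer n d) (C : Circuit n d q w)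
    (next : Basis n d q w → CQScheme n d q w) :
    (run C next).rejectProb F = ∑ z, C.outcomeProb F z * (next z).rejectProb F := by
  simp only [rejectProb, acceptProb, mul_sub, mul_one, sum_sub_distrib, sum_outcomeProb]

/-- The probability that the simulation of a scheme outputs `0`, in which the circuits are
simulated. If more than `B` paths are found in the simulation of a circuit, then the simulation is
aborted without output. -/
def simReject (ω : Sample n d) (θ : ℝ) (B : ℕ) (f : Bits n → Bits n) : CQScheme n d q w → ℝ
  | output b => if b then 0 else 1
  | coin next => ((next false).simReject ω θ B f + (next true).simReject ω θ B f) / 2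
  | query j x next => (next (shuffling (trueLevels ω) f j x)).simReject ω θ B f
  | run C next => ∑ z, (if #(simFound C ω f θ) ≤ B then simProb C ω f θ z else 0) *
      (next z).simReject ω θ B f

/-- A bound on the probability that the simulation is aborted, with all transcripts counted as
if they were certain. -/
def overflow (ω : Sample n d) (θ : ℝ) (B : ℕ) (f : Bits n → Bits n) : CQScheme n d q w → ℝ
  | output _ => 0
  | coin next => ((next false).overflow ω θ B f + (next true).overflow ω θ B f) / 2
  | query _ _ next => ∑ a, (next a).overflow ω θ B f
  | run C next => (if B < #(simFound C ω f θ) then 1 else 0) + ∑ z, (next z).overflow ω θ B f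

theorem simReject_mem (ω : Sample n d) (θ : ℝ) (B : ℕ) (f : Bits n → Bits n)
    (A : CQScheme n d q w) : 0 ≤ A.simReject ω θ B f ∧ A.simReject ω θ B f ≤ 1 := by
  induction A with
  | output b => cases b <;> simp [simReject]
  | coin next ih =>
    have h₀ := ih false
    have h₁ := ih true
    simp only [simReject]
    constructor <;> linarith [h₀.1, h₀.2, h₁.1, h₁.2]
  | query j x next ih => exact ih _
  | run C next ih =>
    simp only [simReject]
    have hp := simProb_nonneg C ω f θ
    constructor
    · refine sum_nonneg fun z _ => mul_nonneg ?_ (ih z).1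
      split_ifs
      exacts [hp z, le_rfl]
    · rw [← sum_simProb C ω f θ]
      refine sum_le_sum fun z _ => ?_
      split_ifs
      · exact mul_le_of_le_one_right (hp z) (ih z).2
      · rw [zero_mul]; exact hp z

theorem overflow_nonneg (ω : Sample n d) (θ : ℝ) (B : ℕ) (f : Bits n → Bits n)
    (A : CQScheme n d q w) : 0 ≤ A.overflow ω θ B f := by
  induction A with
  | output b => exact le_rfl
  | coin next ih =>
    simp only [overflow]
    linarith [ih false, ih true]
  | query j x next ih => exact sum_nonneg fun a _ => ih a
  | run C next ih =>
    simp only [overflow]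
    refine add_nonneg ?_ (sum_nonneg fun z _ => ih z)
    split_ifs <;> norm_num

theorem steps_next_query_le (j : Fin (d + 1)) (x : Dom n d) (next : Answer n d → CQScheme n d q w)
    (a : Answer n d) : (next a).steps + 1 ≤ (query j x next).steps := by
  have := le_sup (f := fun a => (next a).steps) (mem_univ a)
  simp only [steps]
  omega

theorem steps_next_run_le (C : Circuit n d q w) (next : Basis n d q w → CQScheme n d q w)
    (z : Basis n d q w) : (next z).steps + 1 ≤ (run C next).steps := by
  have := le_sup (f := fun z => (next z).steps) (mem_univ z)
  simp only [steps]
  omega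

/-- A classical query reveals at most one value of `f`; a simulated circuit that is not aborted uses
at most `B`, with the found set as certificate. -/
theorem isLocal_simReject (ω : Sample n d) (θ : ℝ) (B : ℕ) (A : CQScheme n d q w) :
    IsLocal (A.steps * (B + 1)) fun f => A.simReject ω θ B f := by
  classical
  induction A with
  | output b =>
    have hb : (0 : ℝ) ≤ if b then 0 else 1 := by split_ifs <;> norm_num
    exact IsLocal.const hb
  | coin next ih =>
    have h₀ := (ih false).mono (Nat.mul_le_mul_right (B + 1)
      (le_max_left (next false).steps (next true).steps))
    have h₁ := (ih true).mono (Nat.mul_le_mul_right (B + 1)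
      (le_max_right (next false).steps (next true).steps))
    have := (h₀.add h₁).const_mul (c := 1 / 2) (by norm_num)
    refine cast ?_ this
    congr 1
    funext f
    simp only [simReject]
    ring
  | query j x next ih =>
    have hmono : ∀ a, (next a).steps * (B + 1) + (B + 1) ≤
        (query j x next).steps * (B + 1) := fun a => by
      rw [← Nat.succ_mul]
      exact Nat.mul_le_mul_right _ (steps_next_query_le j x next a)
    simp only [simReject, shuffling]
    by_cases hj : (j : ℕ) < d
    · simp only [dif_pos hj]
      exact (ih _).mono ((Nat.le_add_right _ _).trans (hmono _))
    · simp only [dif_neg hj]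
      by_cases hx : ∃ x', chain (trueLevels ω) (pad x') = x
      · obtain ⟨x', rfl⟩ := hx
        simp only [lastLevel_chain]
        have : (fun f : Bits n → Bits n => (next (pad (f x'), 0)).simReject ω θ B f) =
            fun f => ∑ v, (if ∀ y ∈ ({x'} : Finset (Bits n)), f y = (fun _ => v) y then (1 : ℝ)
              else 0) * (next (pad v, 0)).simReject ω θ B f := by
          funext f
          simp
        rw [this]
        refine IsLocal.sum _ fun v _ => ?_
        refine IsLocal.mono ((IsLocal.indicator (Q := B + 1) {x'} (fun _ => v) zero_le_one
          (by simp)).mul (ih (pad v, 0))) ?_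
        rw [add_comm]
        exact hmono _
      · push Not at hx
        simp only [lastLevel_of_forall_ne _ _ hx]
        exact (ih _).mono ((Nat.le_add_right _ _).trans (hmono _))
  | run C next ih =>
    simp only [simReject]
    refine IsLocal.sum _ fun z _ => ?_
    have hmono : B + (next z).steps * (B + 1) ≤ (run C next).steps * (B + 1) := by
      refine le_trans ?_ (Nat.mul_le_mul_right (B + 1) (steps_next_run_le C next z))
      rw [Nat.succ_mul]
      omega
    refine IsLocal.mono (IsLocal.mul ?_ (ih z)) hmono
    refine IsLocal.of_certificate (fun f => simFound C ω f θ) (fun f => ?_) (fun f f' hf => ?_)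
      fun f hf => ?_
    · split_ifs
      exacts [simProb_nonneg C ω f θ z, le_rfl]
    · have hrun : simRun C ω f θ d le_rfl = simRun C ω f' θ d le_rfl :=
        simRun_congr_function C ω θ d le_rfl fun x hx => (hf x hx).symm
      have h₁ : simFound C ω f' θ = simFound C ω f θ := by
        unfold simFound; rw [hrun]
      refine ⟨h₁, ?_⟩
      rw [h₁]
      unfold simProb simFinal
      rw [hrun]
    · by_contra hB
      exact hf (if_neg hB)

/-- Aborting only lowers `simReject`, so no overflow term appears in this direction. -/
theorem simReject_le (A : CQScheme n d q w) {ω : Sample n d} (hω : IsGood ω) {θ : ℝ} (hθ : 0 ≤ θ)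
    (B : ℕ) (f : Bits n → Bits n) : A.simReject ω θ B f ≤
      A.rejectProb (shuffling (trueLevels ω) f) + A.steps * (2 * simError n d θ) := by
  have hε : 0 ≤ simError n d θ := by unfold simError; positivity
  induction A with
  | output b => cases b <;> simp [simReject, rejectProb, acceptProb, steps]
  | coin next ih =>
    have h₀ : ((next false).steps : ℝ) ≤ (coin next).steps := by
      exact_mod_cast le_max_left _ _
    have h₁ : ((next true).steps : ℝ) ≤ (coin next).steps := by
      exact_mod_cast le_max_right _ _
    rw [rejectProb_coin]
    simp only [simReject]
    nlinarith [ih false, ih true]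
  | query j x next ih =>
    have h₀ : ((next (shuffling (trueLevels ω) f j x)).steps : ℝ) ≤ (query j x next).steps := by
      have := steps_next_query_le j x next (shuffling (trueLevels ω) f j x)
      exact_mod_cast (Nat.le_succ _).trans this
    refine (ih (shuffling (trueLevels ω) f j x)).trans ?_
    refine add_le_add le_rfl (mul_le_mul_of_nonneg_right h₀ (by positivity))
  | run C next ih =>
    set F := shuffling (trueLevels ω) f
    rw [rejectProb_run]
    simp only [simReject]
    have hs : ∀ z, ((next z).steps : ℝ) * (2 * simError n d θ) ≤
        (((run C next).steps : ℝ) - 1) * (2 * simError n d θ) := by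
      intro z
      have : ((next z).steps : ℝ) + 1 ≤ (run C next).steps := by
        exact_mod_cast steps_next_run_le C next z
      exact mul_le_mul_of_nonneg_right (by linarith) (by positivity)
    have hz : ∀ z, (if #(simFound C ω f θ) ≤ B then simProb C ω f θ z else 0) *
        (next z).simReject ω θ B f ≤ C.outcomeProb F z * (next z).rejectProb F +
          |C.outcomeProb F z - simProb C ω f θ z| +
          simProb C ω f θ z * ((((run C next).steps : ℝ) - 1) * (2 * simError n d θ)) := by
      intro z
      have hp := simProb_nonneg C ω f θ z
      have hr := (simReject_mem ω θ B f (next z)).1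
      have h₁ : (if #(simFound C ω f θ) ≤ B then simProb C ω f θ z else 0) *
          (next z).simReject ω θ B f ≤ simProb C ω f θ z * (next z).simReject ω θ B f := by
        refine mul_le_mul_of_nonneg_right ?_ hr
        split_ifs
        exacts [le_rfl, hp]
      have h₂ : simProb C ω f θ z * (next z).simReject ω θ B f ≤ simProb C ω f θ z *
          ((next z).rejectProb F + (((run C next).steps : ℝ) - 1) * (2 * simError n d θ)) :=
        mul_le_mul_of_nonneg_left ((ih z).trans (add_le_add le_rfl (hs z))) hp
      have h₃ : (simProb C ω f θ z - C.outcomeProb F z) * (next z).rejectProb F ≤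
          |C.outcomeProb F z - simProb C ω f θ z| := by
        rw [abs_sub_comm]
        exact (mul_le_mul_of_nonneg_right (le_abs_self _) (rejectProb_nonneg F _)).trans
          (mul_le_of_le_one_right (abs_nonneg _) (rejectProb_le_one F _))
      linarith
    refine (sum_le_sum fun z _ => hz z).trans ?_
    rw [sum_add_distrib, sum_add_distrib, ← sum_mul, sum_simProb]
    have := sum_abs_outcomeProb_sub_simProb_le C hω f hθ
    linarith

/-- Here an abort has to be paid for: if too many paths are found, then `overflow` is at least `1`
and the bound is trivial. -/
theorem rejectProb_le (A : CQScheme n d q w) {ω : Sample n d} (hω : IsGood ω) {θ : ℝ} (hθ : 0 ≤ θ)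
    (B : ℕ) (f : Bits n → Bits n) : A.rejectProb (shuffling (trueLevels ω) f) ≤
      A.simReject ω θ B f + A.steps * (2 * simError n d θ) + A.overflow ω θ B f := by
  have hε : 0 ≤ simError n d θ := by unfold simError; positivity
  induction A with
  | output b => cases b <;> simp [simReject, rejectProb, acceptProb, steps, overflow]
  | coin next ih =>
    have h₀ : ((next false).steps : ℝ) ≤ (coin next).steps := by
      exact_mod_cast le_max_left _ _
    have h₁ : ((next true).steps : ℝ) ≤ (coin next).steps := by
      exact_mod_cast le_max_right _ _
    rw [rejectProb_coin]
    simp only [simReject, overflow]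
    nlinarith [ih false, ih true]
  | query j x next ih =>
    have h₀ : ((next (shuffling (trueLevels ω) f j x)).steps : ℝ) ≤ (query j x next).steps := by
      have := steps_next_query_le j x next (shuffling (trueLevels ω) f j x)
      exact_mod_cast (Nat.le_succ _).trans this
    refine (ih (shuffling (trueLevels ω) f j x)).trans ?_
    refine add_le_add (add_le_add le_rfl (mul_le_mul_of_nonneg_right h₀ (by positivity))) ?_
    exact single_le_sum (f := fun a => (next a).overflow ω θ B f)
      (fun a _ => overflow_nonneg ω θ B f _) (mem_univ _)
  | run C next ih =>
    set F := shuffling (trueLevels ω) f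
    rw [rejectProb_run]
    simp only [simReject, overflow]
    have hs : ∀ z, ((next z).steps : ℝ) * (2 * simError n d θ) ≤
        (((run C next).steps : ℝ) - 1) * (2 * simError n d θ) := by
      intro z
      have : ((next z).steps : ℝ) + 1 ≤ (run C next).steps := by
        exact_mod_cast steps_next_run_le C next z
      exact mul_le_mul_of_nonneg_right (by linarith) (by positivity)
    by_cases hB : #(simFound C ω f θ) ≤ B
    · have hz : ∀ z, C.outcomeProb F z * (next z).rejectProb F ≤
          simProb C ω f θ z * (next z).simReject ω θ B f +
          |C.outcomeProb F z - simProb C ω f θ z| +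
          simProb C ω f θ z * ((((run C next).steps : ℝ) - 1) * (2 * simError n d θ)) +
          (next z).overflow ω θ B f := by
        intro z
        have hp := simProb_nonneg C ω f θ z
        have hp1 : simProb C ω f θ z ≤ 1 := by
          rw [← sum_simProb C ω f θ]
          exact single_le_sum (f := fun z => simProb C ω f θ z)
            (fun z _ => simProb_nonneg C ω f θ z) (mem_univ z)
        have h₂ : simProb C ω f θ z * (next z).rejectProb F ≤ simProb C ω f θ z *
            ((next z).simReject ω θ B f + (((run C next).steps : ℝ) - 1) * (2 * simError n d θ) +
              (next z).overflow ω θ B f) :=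
          mul_le_mul_of_nonneg_left ((ih z).trans
            (add_le_add (add_le_add le_rfl (hs z)) le_rfl)) hp
        have h₃ : (C.outcomeProb F z - simProb C ω f θ z) * (next z).rejectProb F ≤
            |C.outcomeProb F z - simProb C ω f θ z| :=
          (mul_le_mul_of_nonneg_right (le_abs_self _) (rejectProb_nonneg F _)).trans
            (mul_le_of_le_one_right (abs_nonneg _) (rejectProb_le_one F _))
        have h₄ : simProb C ω f θ z * (next z).overflow ω θ B f ≤ (next z).overflow ω θ B f :=
          mul_le_of_le_one_left (overflow_nonneg ω θ B f _) hp1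
        linarith
      refine (sum_le_sum fun z _ => hz z).trans ?_
      rw [sum_add_distrib, sum_add_distrib, sum_add_distrib, ← sum_mul, sum_simProb]
      have := sum_abs_outcomeProb_sub_simProb_le C hω f hθ
      simp only [if_pos hB, if_neg (not_lt.2 hB)]
      linarith
    · have h₁ : ∑ z, C.outcomeProb F z * (next z).rejectProb F ≤ 1 := by
        rw [← rejectProb_run]
        exact rejectProb_le_one F _
      simp only [if_neg hB, if_pos (not_le.1 hB), zero_mul, sum_const_zero]
      have h₂ : 0 ≤ ∑ z, (next z).overflow ω θ B f :=
        sum_nonneg fun z _ => overflow_nonneg ω θ B f _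
      have h₃ : 0 ≤ ((run C next).steps : ℝ) * (2 * simError n d θ) := by positivity
      linarith

/-- Summing over all answers and outcomes, whatever the sample, leaves only circuits that do not
depend on the sample, to which `hδ` applies. -/
theorem expect_overflow_le (A : CQScheme n d q w) {θ δ K : ℝ} {B : ℕ} (f : Bits n → Bits n)
    (hδ : ∀ C : Circuit n d q w,
      𝔼 ω : Sample n d, (if B < #(simFound C ω f θ) then (1 : ℝ) else 0) ≤ δ)
    (hδ0 : 0 ≤ δ) (hK : 1 ≤ K) (hKa : (Fintype.card (Answer n d) : ℝ) ≤ K)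
    (hKb : (Fintype.card (Basis n d q w) : ℝ) ≤ K) {m : ℕ} (hm : A.steps ≤ m) :
    𝔼 ω : Sample n d, A.overflow ω θ B f ≤ m * K ^ m * δ := by
  induction A generalizing m with
  | output b => simp only [overflow, expect_const_zero]; positivity
  | coin next ih =>
    have h₀ := ih false ((le_max_left _ _).trans hm)
    have h₁ := ih true ((le_max_right _ _).trans hm)
    simp only [overflow]
    rw [← expect_div, expect_add_distrib]
    linarith
  | query j x next ih =>
    obtain ⟨m, rfl⟩ : ∃ k, m = k + 1 := by
      have := steps_next_query_le j x next 0
      exact ⟨m - 1, by omega⟩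
    simp only [overflow]
    rw [expect_sum_comm]
    calc _ ≤ ∑ _a : Answer n d, m * K ^ m * δ := sum_le_sum fun a _ =>
          ih a (by have := steps_next_query_le j x next a; omega)
      _ = Fintype.card (Answer n d) * (m * K ^ m * δ) := by
          rw [sum_const, nsmul_eq_mul, card_univ]
      _ ≤ K * (m * K ^ m * δ) := mul_le_mul_of_nonneg_right hKa (by positivity)
      _ = m * (K ^ (m + 1) * δ) := by ring
      _ ≤ (m + 1 : ℕ) * (K ^ (m + 1) * δ) :=
          mul_le_mul_of_nonneg_right (by push_cast; linarith) (by positivity)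
      _ = _ := by ring
  | run C next ih =>
    obtain ⟨m, rfl⟩ : ∃ k, m = k + 1 := by
      have := steps_next_run_le C next 0
      exact ⟨m - 1, by omega⟩
    simp only [overflow]
    rw [expect_add_distrib, expect_sum_comm]
    calc _ ≤ δ + ∑ _z : Basis n d q w, m * K ^ m * δ := add_le_add (hδ C) (sum_le_sum fun z _ =>
          ih z (by have := steps_next_run_le C next z; omega))
      _ = δ + Fintype.card (Basis n d q w) * (m * K ^ m * δ) := by
          rw [sum_const, nsmul_eq_mul, card_univ]
      _ ≤ K ^ (m + 1) * δ + K * (m * K ^ m * δ) :=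
          add_le_add (le_mul_of_one_le_left hδ0 (one_le_pow₀ hK))
            (mul_le_mul_of_nonneg_right hKb (by positivity))
      _ = _ := by push_cast; ring

/-! ### The bound on the success probability -/

theorem successProb_le_one (A : CQScheme n d q w) : A.successProb ≤ 1 := by
  have h₁ : 𝔼 f ∈ simonFunctions n, 𝔼 σ : Levels n d, A.acceptProb (shuffling σ f) ≤ 1 := by
    rcases (simonFunctions n).eq_empty_or_nonempty with h | h
    · simp [h]
    · exact expect_le h fun f _ => expect_le univ_nonempty fun σ _ => (acceptProb_mem _ A).2
  have h₂ : 𝔼 f ∈ injectiveFunctions n, 𝔼 σ : Levels n d,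
      (1 - A.acceptProb (shuffling σ f)) ≤ 1 := by
    rcases (injectiveFunctions n).eq_empty_or_nonempty with h | h
    · simp [h]
    · exact expect_le h fun f _ => expect_le univ_nonempty fun σ _ => A.rejectProb_le_one _
  unfold successProb
  linarith

theorem injectiveFunctions_nonempty (n : ℕ) : (injectiveFunctions n).Nonempty :=
  ⟨id, by simp [injectiveFunctions, Function.injective_id]⟩

theorem successProb_le (A : CQScheme n d q w) (hn : 0 < n) {θ δ K : ℝ} {B m : ℕ} (hθ : 0 ≤ θ)
    (hδ : ∀ (f : Bits n → Bits n) (C : Circuit n d q w),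
      𝔼 ω : Sample n d, (if B < #(simFound C ω f θ) then (1 : ℝ) else 0) ≤ δ)
    (hδ0 : 0 ≤ δ) (hK : 1 ≤ K) (hKa : (Fintype.card (Answer n d) : ℝ) ≤ K)
    (hKb : (Fintype.card (Basis n d q w) : ℝ) ≤ K) (hm : A.steps ≤ m) :
    A.successProb ≤ 1 / 2 + (2 * (m * (B + 1) : ℕ) ^ 2 / 2 ^ n + 4 * m * (2 * simError n d θ) / 2 +
      2 * (2 * d * 4 ^ n / 2 ^ ((d + 2) * n)) + m * K ^ m * δ) / 2 := by
  classical
  have hε : 0 ≤ simError n d θ := by unfold simError; positivity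
  set e : ℝ := m * (2 * simError n d θ) with he
  set κ : ℝ := 2 * (m * (B + 1) : ℕ) ^ 2 / 2 ^ n with hκ
  set b : Sample n d → ℝ := fun ω => if IsGood ω then (0 : ℝ) else 1 with hb
  have hme : (A.steps : ℝ) * (2 * simError n d θ) ≤ e :=
    mul_le_mul_of_nonneg_right (by exact_mod_cast hm) (by positivity)
  have he0 : 0 ≤ e := by positivity
  have hbE : 𝔼 ω, b ω ≤ 2 * d * 4 ^ n / 2 ^ ((d + 2) * n) := expect_not_isGood_le
  set rej : (Bits n → Bits n) → ℝ := fun f =>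
    𝔼 σ : Levels n d, A.rejectProb (shuffling σ f) with hrej
  have hrejω : ∀ f, rej f = 𝔼 ω : Sample n d, A.rejectProb (shuffling (trueLevels ω) f) :=
    fun f => (expect_trueLevels fun σ => A.rejectProb (shuffling σ f)).symm
  have hlow : ∀ f, 𝔼 ω : Sample n d, A.simReject ω θ B f ≤ rej f + e + 𝔼 ω, b ω := by
    intro f
    rw [hrejω]
    calc _ ≤ 𝔼 ω : Sample n d, (A.rejectProb (shuffling (trueLevels ω) f) + e + b ω) := by
          refine expect_le_expect fun ω _ => ?_
          by_cases hω : IsGood ω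
          · have := A.simReject_le hω hθ B f
            simp only [hb, if_pos hω]
            linarith
          · have h₁ := (simReject_mem ω θ B f A).2
            have h₂ := A.rejectProb_nonneg (shuffling (trueLevels ω) f)
            simp only [hb, if_neg hω]
            linarith
      _ = _ := by
          rw [expect_add_distrib, expect_add_distrib, Fintype.expect_const]
  have hup : ∀ f, rej f ≤ 𝔼 ω : Sample n d, A.simReject ω θ B f + e + 𝔼 ω, b ω + m * K ^ m * δ := by
    intro f
    rw [hrejω]
    calc _ ≤ 𝔼 ω : Sample n d, (A.simReject ω θ B f + e + b ω + A.overflow ω θ B f) := by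
          refine expect_le_expect fun ω _ => ?_
          have h₀ := overflow_nonneg ω θ B f A
          by_cases hω : IsGood ω
          · have := A.rejectProb_le hω hθ B f
            simp only [hb, if_pos hω]
            linarith
          · have h₁ := (simReject_mem ω θ B f A).1
            have h₂ := A.rejectProb_le_one (shuffling (trueLevels ω) f)
            simp only [hb, if_neg hω]
            linarith
      _ ≤ _ := by
          rw [expect_add_distrib, expect_add_distrib, expect_add_distrib, Fintype.expect_const]
          exact add_le_add le_rfl (expect_overflow_le A f (hδ f) hδ0 hK hKa hKb hm)
  have hS := simonFunctions_nonempty hn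
  have hI := injectiveFunctions_nonempty n
  -- Locality in `f` holds for a fixed sample, so the two kinds of functions are compared before
  -- averaging over samples.
  have hloc : ∀ ω : Sample n d, 𝔼 f ∈ injectiveFunctions n, A.simReject ω θ B f - κ ≤
      𝔼 f ∈ simonFunctions n, A.simReject ω θ B f := by
    intro ω
    have h₁ := ((isLocal_simReject ω θ B A).mono
      (Nat.mul_le_mul_right (B + 1) hm)).expect_injective_le hn
    have h₂ : 𝔼 f ∈ injectiveFunctions n, A.simReject ω θ B f ≤ 1 :=
      expect_le hI fun f _ => (simReject_mem ω θ B f A).2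
    have h₃ : 0 ≤ κ := by positivity
    nlinarith
  have hlocE : 𝔼 f ∈ injectiveFunctions n, 𝔼 ω : Sample n d, A.simReject ω θ B f - κ ≤
      𝔼 f ∈ simonFunctions n, 𝔼 ω : Sample n d, A.simReject ω θ B f := by
    rw [expect_comm, expect_comm (simonFunctions n)]
    have := expect_le_expect (s := univ) fun ω (_ : ω ∈ univ) => hloc ω
    rwa [expect_sub_distrib, Fintype.expect_const] at this
  have hSE : 𝔼 f ∈ simonFunctions n, 𝔼 ω : Sample n d, A.simReject ω θ B f ≤
      𝔼 f ∈ simonFunctions n, rej f + e + 𝔼 ω, b ω := by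
    have := expect_le_expect (s := simonFunctions n) fun f (_ : f ∈ _) => hlow f
    rwa [expect_add_distrib, expect_add_distrib, expect_const hS, expect_const hS] at this
  have hIE : 𝔼 f ∈ injectiveFunctions n, rej f ≤ 𝔼 f ∈ injectiveFunctions n,
      𝔼 ω : Sample n d, A.simReject ω θ B f + e + 𝔼 ω, b ω + m * K ^ m * δ := by
    have := expect_le_expect (s := injectiveFunctions n) fun f (_ : f ∈ _) => hup f
    rwa [expect_add_distrib, expect_add_distrib, expect_add_distrib, expect_const hI,
      expect_const hI, expect_const hI] at this
  have hacc : 𝔼 f ∈ simonFunctions n, 𝔼 σ : Levels n d, A.acceptProb (shuffling σ f) =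
      1 - 𝔼 f ∈ simonFunctions n, rej f := by
    have : ∀ f, 𝔼 σ : Levels n d, A.acceptProb (shuffling σ f) = 1 - rej f := by
      intro f
      simp only [hrej, rejectProb]
      rw [expect_sub_distrib, Fintype.expect_const]
      ring
    simp only [this]
    rw [expect_sub_distrib, expect_const hS]
  have hrejI : 𝔼 f ∈ injectiveFunctions n, 𝔼 σ : Levels n d, (1 - A.acceptProb (shuffling σ f)) =
      𝔼 f ∈ injectiveFunctions n, rej f := rfl
  unfold successProb
  rw [hacc, hrejI]
  have hee : 4 * m * (2 * simError n d θ) / 2 = 2 * e := by rw [he]; ring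
  linarith

end CQScheme

/-! ### Polynomial bounds -/

theorem card_answer : Fintype.card (Answer n d) = 2 ^ ((d + 2) * n + 1) := by
  simp [ZMod.card, pow_succ]

theorem card_basis : Fintype.card (Basis n d q w) = 2 ^ numQubits n d q w := by
  simp only [Fintype.card_prod, Fintype.card_pi, ZMod.card, prod_const, card_univ, Fintype.card_fin,
    numQubits, ← pow_add, ← pow_mul, ← pow_succ]
  congr 1
  ring

theorem le_numQubits (hq : 0 < q) : d + 1 ≤ numQubits n d q w ∧ q ≤ numQubits n d q w ∧
    (d + 2) * n + 1 ≤ numQubits n d q w := by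
  set N := (d + 2) * n
  have h : numQubits n d q w = (d + 1) * q * (N + (N + 1)) + w := rfl
  rw [h]
  have h₁ : d + 1 ≤ (d + 1) * q := Nat.le_mul_of_pos_right _ hq
  have h₂ : q ≤ (d + 1) * q := Nat.le_mul_of_pos_left _ (by omega)
  have h₃ : (d + 1) * q ≤ (d + 1) * q * (N + (N + 1)) := Nat.le_mul_of_pos_right _ (by omega)
  have h₄ : N + (N + 1) ≤ (d + 1) * q * (N + (N + 1)) := Nat.le_mul_of_pos_left _ (by positivity)
  omega

theorem two_mul_four_pow_div_le (hn : 0 < n) :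
    (2 * d * 4 ^ n / 2 ^ ((d + 2) * n) : ℝ) ≤ 2 / 2 ^ n := by
  have h₁ : d * 2 ^ n ≤ 2 ^ (d * n) := by
    cases d with
    | zero => simp
    | succ d =>
      rw [Nat.succ_mul d n, pow_add]
      refine Nat.mul_le_mul_right _ ?_
      calc d + 1 ≤ 2 ^ d := Nat.lt_two_pow_self
        _ ≤ 2 ^ (d * n) := Nat.pow_le_pow_right (by norm_num) (Nat.le_mul_of_pos_right d hn)
  have h₂ : (d * 2 ^ n : ℝ) ≤ 2 ^ (d * n) := by exact_mod_cast h₁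
  rw [div_le_div_iff₀ (by positivity) (by positivity), add_mul, pow_add,
    show (4 : ℝ) ^ n = 2 ^ n * 2 ^ n by rw [← mul_pow]; norm_num,
    show (2 : ℝ) ^ (2 * n) = 2 ^ n * 2 ^ n by rw [two_mul, pow_add]]
  have h₃ : (0 : ℝ) < 2 ^ n := by positivity
  have h₄ := mul_le_mul_of_nonneg_right h₂ (mul_nonneg h₃.le h₃.le)
  nlinarith

/-- The square of the error is `64 * d ^ 3 * (d + 1) * q / 2 ^ (d * n)`, and `d ≥ 1` in the
nontrivial case. -/
theorem simError_threshold_le {P : ℕ} (hP : numQubits n d q w ≤ P) :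
    simError n d (threshold n d q) ≤ √(64 * P ^ 5 / 2 ^ n) := by
  rcases Nat.eq_zero_or_pos d with rfl | hd
  · rw [simError, Nat.cast_zero, zero_mul]
    exact Real.sqrt_nonneg _
  rcases Nat.eq_zero_or_pos q with rfl | hq
  · rw [show simError n d (threshold n d 0) = 0 by simp [simError, threshold]]
    exact Real.sqrt_nonneg _
  have hb := le_numQubits (n := n) (d := d) (w := w) hq
  have hdP : (d : ℝ) + 1 ≤ P := by exact_mod_cast hb.1.trans hP
  have hqP : (q : ℝ) ≤ P := by exact_mod_cast hb.2.1.trans hP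
  have h₀ : 0 ≤ (2 : ℝ) ^ n * (2 * (d + 1)) * threshold n d q :=
    mul_nonneg (by positivity) threshold_nonneg
  refine Real.le_sqrt_of_sq_le ?_
  unfold simError
  rw [mul_pow, mul_pow, Real.sq_sqrt h₀]
  have hpow : (2 : ℝ) ^ ((d + 2) * n) = 2 ^ (d * n) * (2 ^ n * 2 ^ n) := by
    rw [add_mul, pow_add, two_mul, pow_add]
  have hdn : (2 : ℝ) ^ n ≤ 2 ^ (d * n) :=
    pow_le_pow_right₀ (by norm_num) (Nat.le_mul_of_pos_left n hd)
  have h₁ : (d : ℝ) ^ 2 * (2 ^ 2 * (2 ^ n * (2 * (d + 1)) * threshold n d q)) =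
      64 * (d ^ 3 * (d + 1) * q) / 2 ^ (d * n) := by
    unfold threshold
    rw [hpow]
    field_simp
    norm_num
  rw [h₁]
  have h₂ : (d : ℝ) ^ 3 * (d + 1) * q ≤ P ^ 5 := by
    calc (d : ℝ) ^ 3 * (d + 1) * q ≤ (P : ℝ) ^ 3 * P * P := by
          gcongr
          linarith
      _ = _ := by ring
  calc _ ≤ 64 * (P : ℝ) ^ 5 / 2 ^ (d * n) := by gcongr
    _ ≤ _ := by gcongr

/-- The transcripts contribute `2 ^ (P ^ 2)`, and `P`, `d`, `q` are at most `2 ^ P` each; the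
exponent `P ^ 2 + 3 * P + n` absorbs all this and leaves `2 ^ (-n)`. -/
theorem overflow_numeric_le {P : ℕ} (n d q w : ℕ) (hP : numQubits n d q w ≤ P) (hq : 0 < q) :
    (P : ℝ) * (2 ^ P) ^ P * (d * q * (1 / 4) ^ (P ^ 2 + 3 * P + n)) ≤ 1 / 2 ^ n := by
  have hb := le_numQubits (n := n) (d := d) (w := w) hq
  have hP2 : (P : ℝ) ≤ 2 ^ P := by exact_mod_cast Nat.lt_two_pow_self.le
  have hdP : (d : ℝ) ≤ 2 ^ P := by
    refine le_trans ?_ hP2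
    exact_mod_cast (Nat.le_succ d).trans (hb.1.trans hP)
  have hqP : (q : ℝ) ≤ 2 ^ P := by
    refine le_trans ?_ hP2
    exact_mod_cast hb.2.1.trans hP
  have hquarter : ((1 : ℝ) / 4) ^ (P ^ 2 + 3 * P + n) ≤ (1 / 2) ^ (P ^ 2 + 3 * P + n) :=
    pow_le_pow_left₀ (by norm_num) (by norm_num) _
  calc _ ≤ (2 : ℝ) ^ P * (2 ^ P) ^ P * (2 ^ P * 2 ^ P * (1 / 2) ^ (P ^ 2 + 3 * P + n)) := by
        gcongr
    _ = 1 / 2 ^ n := by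
        rw [one_div, inv_pow, pow_add, pow_add, ← pow_mul, sq]
        have : (2 : ℝ) ^ (3 * P) = 2 ^ P * 2 ^ P * 2 ^ P := by
          rw [← pow_add, ← pow_add]; congr 1; ring
        rw [this]
        field_simp

/-- The number of paths that may be found in each simulation of a circuit. -/
def foundBound (P n : ℕ) : ℕ := P * (P ^ 2 + 3 * P + n)

theorem CQScheme.successProb_le_of_numQubits_le (A : CQScheme n d q w) (hn : 0 < n) {P : ℕ}
    (hP : numQubits n d q w ≤ P) (hA : A.steps ≤ P) :
    A.successProb ≤ 1 / 2 + (((P * (foundBound P n + 1)) ^ 2 + 3 : ℕ) / 2 ^ n +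
      √((256 * P ^ 7 : ℕ) / 2 ^ n)) := by
  classical
  set R := P ^ 2 + 3 * P + n with hR
  obtain ⟨r, K, hrP, hK1, hKa, hKb, hov⟩ : ∃ (r : ℕ) (K : ℝ), d * r ≤ foundBound P n ∧ 1 ≤ K ∧
      (Fintype.card (Answer n d) : ℝ) ≤ K ∧ (Fintype.card (Basis n d q w) : ℝ) ≤ K ∧
      (P : ℝ) * K ^ P * (d * q * (1 / 4) ^ r) ≤ 1 / 2 ^ n := by
    -- Without query registers the number of qubits bounds neither `n` nor `d`, so `2 ^ P` need not
    -- bound the number of answers. But then the overflow term is zero and any `K` will do.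
    rcases Nat.eq_zero_or_pos q with rfl | hq
    · refine ⟨0, max 1 (max (Fintype.card (Answer n d)) (Fintype.card (Basis n d 0 w))), by simp,
        le_max_left _ _, (le_max_left _ _).trans (le_max_right _ _),
        (le_max_right _ _).trans (le_max_right _ _), ?_⟩
      simp
    · have hb := le_numQubits (n := n) (d := d) (w := w) hq
      refine ⟨R, 2 ^ P, Nat.mul_le_mul_right R ((Nat.le_succ d).trans (hb.1.trans hP)),
        one_le_pow₀ (by norm_num), ?_, ?_, overflow_numeric_le n d q w hP hq⟩
      · rw [card_answer]
        push_cast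
        exact pow_le_pow_right₀ (by norm_num) (hb.2.2.trans hP)
      · rw [card_basis]
        push_cast
        exact pow_le_pow_right₀ (by norm_num) hP
  have hmain := A.successProb_le hn (threshold_nonneg (n := n) (d := d) (q := q))
    (fun f C => expect_found_threshold_le C f r) (by positivity) hK1 hKa hKb hA
  have h₁ := two_mul_four_pow_div_le (d := d) hn
  have h₂ := simError_threshold_le hP
  have h₃ : (2 * ((P * (d * r + 1) : ℕ) : ℝ) ^ 2 / 2 ^ n) ≤
      2 * ((P * (foundBound P n + 1) : ℕ) : ℝ) ^ 2 / 2 ^ n := by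
    have : ((P * (d * r + 1) : ℕ) : ℝ) ≤ (P * (foundBound P n + 1) : ℕ) := by
      exact_mod_cast Nat.mul_le_mul_left P (Nat.succ_le_succ hrP)
    gcongr
  have h₄ : 2 * P * √(64 * P ^ 5 / 2 ^ n) = √((256 * P ^ 7 : ℕ) / 2 ^ n) := by
    have : ((256 * P ^ 7 : ℕ) : ℝ) / 2 ^ n = (2 * P) ^ 2 * (64 * P ^ 5 / 2 ^ n) := by
      push_cast; ring
    rw [this, Real.sqrt_mul (by positivity), Real.sqrt_sq (by positivity)]
  have h₅ : 2 * P * simError n d (threshold n d q) ≤ 2 * P * √(64 * P ^ 5 / 2 ^ n) :=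
    mul_le_mul_of_nonneg_left h₂ (by positivity)
  have h₆ : (((P * (foundBound P n + 1)) ^ 2 + 3 : ℕ) : ℝ) / 2 ^ n =
      ((P * (foundBound P n + 1) : ℕ) : ℝ) ^ 2 / 2 ^ n + 3 * (1 / 2 ^ n) := by
    push_cast; ring
  have h₇ : (0 : ℝ) < 1 / 2 ^ n := by positivity
  have h₈ : (2 : ℝ) / 2 ^ n = 2 * (1 / 2 ^ n) := by ring
  have h₉ : 2 * ((P * (foundBound P n + 1) : ℕ) : ℝ) ^ 2 / 2 ^ n =
      2 * (((P * (foundBound P n + 1) : ℕ) : ℝ) ^ 2 / 2 ^ n) := by ring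
  rw [h₆, ← h₄]
  rw [h₉] at h₃
  rw [h₈] at h₁
  linarith

/-- From `(s + t) ^ 2 ≤ 2 * s ^ 2 + 2 * t ^ 2`, and `s ^ 2 ≤ s` for `s = a / M ≤ 1`. -/
theorem div_add_sqrt_div_le {a c : ℕ} {M : ℝ} (hM : 0 < M) (ha : a ≤ M) :
    a / M + √(c / M) ≤ √((2 * (a + c) : ℕ) / M) := by
  have h₀ : 0 ≤ a / M := by positivity
  have h₁ : a / M ≤ 1 := (div_le_one hM).2 ha
  have h₂ : 0 ≤ c / M := by positivity
  refine Real.le_sqrt_of_sq_le ?_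
  have h₃ : (((2 * (a + c) : ℕ) : ℝ)) / M = 2 * (a / M) + 2 * (c / M) := by
    push_cast; ring
  rw [h₃]
  nlinarith [Real.sq_sqrt h₂, sq_nonneg (a / M - √(c / M)), Real.sqrt_nonneg (c / M)]

end ShufflingSimon

end

theorem mainTheorem5 (p : Polynomial ℕ) :
    ∃ r : Polynomial ℕ, ∀ n : ℕ, 0 < n → ∀ (d q w : ℕ) (A : ShufflingSimon.CQScheme n d q w),
      ShufflingSimon.numQubits n d q w ≤ p.eval n → A.steps ≤ p.eval n →
        A.successProb ≤ 1 / 2 + Real.sqrt (((r.eval n : ℕ) : ℝ) / 2 ^ n) := by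
  refine ⟨2 * (((p * (p * (p ^ 2 + 3 * p + Polynomial.X) + 1)) ^ 2 + 3) + 256 * p ^ 7),
    fun n hn d q w A hP hA => ?_⟩
  have heval : (2 * (((p * (p * (p ^ 2 + 3 * p + Polynomial.X) + 1)) ^ 2 + 3) +
      256 * p ^ 7)).eval n = 2 * (((p.eval n * (ShufflingSimon.foundBound (p.eval n) n + 1)) ^ 2
        + 3) + 256 * p.eval n ^ 7) := by
    simp [ShufflingSimon.foundBound]
  rw [heval]
  have hbound := A.successProb_le_of_numQubits_le hn hP hA
  set a := (p.eval n * (ShufflingSimon.foundBound (p.eval n) n + 1)) ^ 2 + 3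
  set c := 256 * p.eval n ^ 7
  have hM : (0 : ℝ) < 2 ^ n := by positivity
  rcases le_total (a : ℝ) (2 ^ n) with ha | ha
  · exact hbound.trans (add_le_add le_rfl (ShufflingSimon.div_add_sqrt_div_le hM ha))
  -- If `a` is at least `2 ^ n`, the claimed bound exceeds `1`.
  · have h₁ : 1 ≤ Real.sqrt (((2 * (a + c) : ℕ) : ℝ) / 2 ^ n) := by
      rw [Real.one_le_sqrt, one_le_div hM]
      push_cast
      have : (0 : ℝ) ≤ c := Nat.cast_nonneg c
      have : (0 : ℝ) ≤ a := Nat.cast_nonneg a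
      linarith
    have h₂ := A.successProb_le_one
    linarith
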